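/- A system $(X,\mathcal F,\mu,T)$ is a probability space with a measurable, measure-preserving map $T:X\to X$ (neither ergodicity nor invertibility is assumed). For $f\in L^\infty(\mu)$ (complex-valued) and $N\ge 1$ put $$W_N^1(f)=\Big\|\sup_{t\in\mathbb R}\Big|\frac1N\sum_{n=1}^N e^{2\pi i n t}\,f\circ T^n\Big|\Big\|_{L^2(\mu)}^{2/3},\qquad W_N^{k}(f)=\frac1{\lfloor\sqrt N\rfloor}\sum_{h=1}^{\lfloor\sqrt N\rfloor}W_N^{k-1}\big(f\cdot\overline{f\circ T^h}\big)\quad(k\ge2).$$ For $\alpha>0$, $f\in L^\infty(\mu)$ is a $k$-th order WW function of power type $\alpha$ if there is $C>0$ with $W_N^k(f)\le C N^{-\alpha}$ for all $N\ge1$. For sequences $r,s:\mathbb N\to[0,\infty)$ write $r\precsim s$ if there are $0<a,b,c\le1$, $C>0$, $N_0\in\mathbb N$ and a nondecreasing $\varphi:\mathbb N\to\mathbb N$ with $\varphi(N)\ge N^{b}$ such that $r(N)\le C\big(N^{-a}+s(\varphi(N))^{c}\big)$ for all $N>N_0$. For $f\in L^\infty(\mu)$ and $g\in L^\infty(\nu)$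 put $(f\otimes g)(x,y)=f(x)g(y)$; its averages are taken in the product system $(X\times Y,\mu\times\nu,T\times S)$. (1) There is an absolute constant $C>0$ such that for all $k\ge1$, all systems $(X,\mathcal F,\mu,T)$ and $(Y,\mathcal G,\nu,S)$, all $f\in L^\infty(\mu)$ and $g\in L^\infty(\nu)$ with $\|f\|_\infty\le1$ and $\|g\|_\infty\le 1$, and all $N\ge1$, $$W_N^k(f\otimes g)\le C\Big(\frac1{N^{1/6}}+\big[\min\{W_N^{k+1}(f),W_N^{k+1}(g)\}\big]^{1/8}\Big).$$ (2) Hence $W_N^k(f\otimes g)\precsim\min\{W_N^{k+1}(f),W_N^{k+1}(g)\}$, where the constants and the function $\varphi$ witnessing $\precsim$ do not depend on $k$, the systems, $f$ or $g$. (3) Let $k\ge1$, $\alpha>0$, and let $f$ be a $(k+1)$-th order WW function of power type $\alpha$ in a system $(X,\mathcal F,\mu,T)$. Then for every system $(Y,\mathcal G,\nu,S)$ and every $g\in L^\infty(\nu)$, $f\otimes g$ is a $k$-th order WW function of power type $\alpha/8$ in the product system. -/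

import Mathlib

open MeasureTheory
open scoped ENNReal

noncomputable section

/-- The uniform Wiener-Wintner maximal function
`x ↦ sup_t |(1/N) ∑_{n=1}^N e^{2πint} f(Tⁿ x)|`. For each `x` the supremum is over a bounded set. -/
def wwSup {X : Type*} (T : X → X) (N : ℕ) (f : X → ℂ) (x : X) : ℝ :=
  ⨆ t : ℝ, ‖(1 / (N : ℂ)) * ∑ n ∈ Finset.Icc 1 N,
    Complex.exp (2 * Real.pi * Complex.I * n * t) * f (T^[n] x)‖

/-- The `k`-th order Wiener-Wintner average `W_N^k(f)` of the system `(X, μ, T)`: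
`W_N^1(f) = ‖sup_t |(1/N) ∑_{n=1}^N e^{2πint} f ∘ Tⁿ|‖_2^{2/3}` and
`W_N^k(f) = (1/⌊√N⌋) ∑_{h=1}^{⌊√N⌋} W_N^{k-1}(f · conj(f ∘ T^h))`.
The orders are `k ≥ 1`; the value at `k = 0` is a placeholder. -/
def wwAvg {X : Type*} [MeasurableSpace X] (μ : Measure X) (T : X → X) (N : ℕ) :
    ℕ → (X → ℂ) → ℝ
  | 0, _ => 0
  | 1, f => (eLpNorm (wwSup T N f) 2 μ).toReal ^ (2 / 3 : ℝ)
  | k + 2, f => (1 / (Nat.sqrt N : ℝ)) * ∑ h ∈ Finset.Icc 1 (Nat.sqrt N),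
      wwAvg μ T N (k + 1) (fun x => f x * (starRingEnd ℂ) (f (T^[h] x)))

/-- `Poly(ℕ, α)`: real sequences with `r(N) ≤ C N^{-α}` for some `C > 0` and all `N ≥ 1`. -/
def PolyDecay (α : ℝ) (r : ℕ → ℝ) : Prop :=
  ∃ C : ℝ, 0 < C ∧ ∀ N : ℕ, 1 ≤ N → r N ≤ C * (N : ℝ) ^ (-α)

/-- `f ∈ L^∞(μ)` is a `k`-th order Wiener-Wintner function of power type `α`. -/
def IsWWFunction {X : Type*} [MeasurableSpace X] (μ : Measure X) (T : X → X) (k : ℕ) (α : ℝ)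
    (f : X → ℂ) : Prop :=
  MemLp f ∞ μ ∧ PolyDecay α (fun N => wwAvg μ T N k f)

/-- The tensor product `(f ⊗ g)(x, y) = f(x) g(y)`. -/
def tensorFun {X Y : Type*} (f : X → ℂ) (g : Y → ℂ) : X × Y → ℂ :=
  fun p => f p.1 * g p.2

/-- The asymptotic comparison `r ≾ s` of nonnegative sequences, witnessed by the given constants
and the given nondecreasing function `φ`. -/
def PrecsimWith (α β γ C : ℝ) (N₀ : ℕ) (φ : ℕ → ℕ) (r s : ℕ → ℝ) : Prop :=
  (0 < α ∧ α ≤ 1) ∧ (0 < β ∧ β ≤ 1) ∧ (0 < γ ∧ γ ≤ 1) ∧ 0 < C ∧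
  Monotone φ ∧ (∀ N : ℕ, (N : ℝ) ^ β ≤ (φ N : ℝ)) ∧
  ∀ N : ℕ, N₀ < N → r N ≤ C * (1 / (N : ℝ) ^ α + s (φ N) ^ γ)

end

/-! Van der Corput's inequality trades the modulation `e^{2πint}` for multiplicative derivatives,
and a derivative of `f ⊗ g` is the tensor product of the derivatives of `f` and `g`. With window `H
= ⌊√N⌋`, the squared supremum for `f ⊗ g` is at most `16/√N` plus `4/H` times the sum over `d ≤ H`
of the unmodulated averages of `F(Tⁿx) G(Sⁿy)`, where `F`, `G` are the `d`-th derivatives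
(`trigSup_sq_le`).

For fixed `x` such an average is a polynomial in the Koopman operator of `S` applied to `G`. By von
Neumann's inequality (`integral_norm_sq_orbit_sum_le`) its `L²(ν)` norm is at most the supremum of
that polynomial on the unit circle, which is `wwSup T N F x`. So `g` drops out, and integration
gives `∫ sup² ≤ 16/√N + 4 W_N^2(f)`. A cube root settles order 1. Higher orders follow by induction,
with `x^{1/8}` passed through the average over `h` by concavity; exchanging the factors gives the
minimum.

For functions of power type, the error `N^{-1/6}` is harmless as long as `α/8 ≤ 1/6`. Large `α` is
covered by rigidity: Parseval's identity gives `∫|f|² ≤ N^{1/3} W_N^1(f)` when `|f| ≤ 1`, and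
quantitative Khintchine recurrence carries a lower bound of this kind to every order
(`exists_wwAvg_lower_bound`). Hence `α > 1/3` forces `f = 0` almost everywhere. -/

/-! ### Trigonometric averages of a sequence -/

/-- `sup_t |(1/N) ∑_{n=1}^N e^{2πint} c_n|`. -/
noncomputable def trigSup (N : ℕ) (c : ℕ → ℂ) : ℝ :=
  ⨆ t : ℝ, ‖(1 / (N : ℂ)) * ∑ n ∈ Finset.Icc 1 N,
    Complex.exp (2 * Real.pi * Complex.I * n * t) * c n‖

theorem norm_exp_two_pi_mul (n : ℕ) (t : ℝ) :
    ‖Complex.exp (2 * Real.pi * Complex.I * n * t)‖ = 1 := by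
  have : (2 * Real.pi * Complex.I * n * t : ℂ) = ((2 * Real.pi * n * t : ℝ) : ℂ) * Complex.I := by
    push_cast; ring
  rw [this, Complex.norm_exp_ofReal_mul_I]

theorem norm_average_le {N : ℕ} {c : ℕ → ℂ} {M : ℝ} (hM : 0 ≤ M) (hc : ∀ n, ‖c n‖ ≤ M) :
    ‖(1 / (N : ℂ)) * ∑ n ∈ Finset.Icc 1 N, c n‖ ≤ M := by
  rcases Nat.eq_zero_or_pos N with rfl | hN
  · simpa using hM
  have hN' : (0 : ℝ) < N := by exact_mod_cast hN
  have h1 : ‖∑ n ∈ Finset.Icc 1 N, c n‖ ≤ N * M := by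
    refine (norm_sum_le_of_le _ (fun n _ => hc n)).trans ?_
    simp
  rw [norm_mul, norm_div, norm_one, Complex.norm_natCast]
  calc 1 / (N : ℝ) * _ ≤ 1 / (N : ℝ) * (N * M) := by gcongr
    _ = M := by field_simp

theorem norm_trigAverage_le {N : ℕ} {c : ℕ → ℂ} {M : ℝ} (hM : 0 ≤ M) (hc : ∀ n, ‖c n‖ ≤ M)
    (t : ℝ) : ‖(1 / (N : ℂ)) * ∑ n ∈ Finset.Icc 1 N,
      Complex.exp (2 * Real.pi * Complex.I * n * t) * c n‖ ≤ M :=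
  norm_average_le hM fun n => by rw [norm_mul, norm_exp_two_pi_mul, one_mul]; exact hc n

theorem bddAbove_trigAverage (N : ℕ) (c : ℕ → ℂ) :
    BddAbove (Set.range fun t : ℝ => ‖(1 / (N : ℂ)) * ∑ n ∈ Finset.Icc 1 N,
      Complex.exp (2 * Real.pi * Complex.I * n * t) * c n‖) := by
  refine ⟨‖(1 / (N : ℂ))‖ * ∑ n ∈ Finset.Icc 1 N, ‖c n‖, ?_⟩
  rintro _ ⟨t, rfl⟩
  simp only [norm_mul]
  gcongr
  refine (norm_sum_le _ _).trans (Finset.sum_le_sum fun n _ => ?_)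
  rw [norm_mul, norm_exp_two_pi_mul, one_mul]

theorem norm_trigAverage_le_trigSup (N : ℕ) (c : ℕ → ℂ) (t : ℝ) :
    ‖(1 / (N : ℂ)) * ∑ n ∈ Finset.Icc 1 N,
      Complex.exp (2 * Real.pi * Complex.I * n * t) * c n‖ ≤ trigSup N c :=
  le_ciSup (bddAbove_trigAverage N c) t

theorem trigSup_nonneg (N : ℕ) (c : ℕ → ℂ) : 0 ≤ trigSup N c :=
  Real.iSup_nonneg fun _ => norm_nonneg _

theorem trigSup_le {N : ℕ} {c : ℕ → ℂ} {M : ℝ} (hM : 0 ≤ M) (hc : ∀ n, ‖c n‖ ≤ M) :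
    trigSup N c ≤ M :=
  ciSup_le fun t => norm_trigAverage_le hM hc t

/-! ### Van der Corput's inequality -/

/-- Each unit shift telescopes to one new end term minus one old one, which costs at most 2. -/
theorem norm_sum_shift_sub_le {b : ℕ → ℂ} (hb : ∀ n, ‖b n‖ ≤ 1) (N h : ℕ) :
    ‖∑ n ∈ Finset.Icc 1 N, b (n + h) - ∑ n ∈ Finset.Icc 1 N, b n‖ ≤ 2 * h := by
  induction h with
  | zero => simp
  | succ h ih =>
    have key : ∀ M : ℕ, ∑ n ∈ Finset.Icc 1 M, b (n + (h + 1)) - ∑ n ∈ Finset.Icc 1 M, b (n + h)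
        = b (M + h + 1) - b (h + 1) := by
      intro M
      induction M with
      | zero => simp
      | succ M ihM =>
        rw [Finset.sum_Icc_succ_top (by omega), Finset.sum_Icc_succ_top (by omega)]
        have : M + 1 + (h + 1) = M + 1 + h + 1 := by ring
        rw [this]
        have h2 : M + h + 1 = M + 1 + h := by ring
        rw [h2] at ihM
        linear_combination ihM
    have h1 := key N
    have h2 : ‖b (N + h + 1) - b (h + 1)‖ ≤ 2 :=
      (norm_sub_le _ _).trans (by linarith [hb (N + h + 1), hb (h + 1)])
    have : ∑ n ∈ Finset.Icc 1 N, b (n + (h + 1)) - ∑ n ∈ Finset.Icc 1 N, b n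
        = (b (N + h + 1) - b (h + 1)) +
          (∑ n ∈ Finset.Icc 1 N, b (n + h) - ∑ n ∈ Finset.Icc 1 N, b n) := by
      rw [← h1]; ring
    rw [this]
    refine (norm_add_le _ _).trans ?_
    push_cast
    linarith

theorem norm_sum_sq_le_card_mul {ι : Type*} (s : Finset ι) (z : ι → ℂ) :
    ‖∑ i ∈ s, z i‖ ^ 2 ≤ s.card * ∑ i ∈ s, ‖z i‖ ^ 2 :=
  (pow_le_pow_left₀ (norm_nonneg _) (norm_sum_le _ _) 2).trans sq_sum_le_card_mul_sum_sq

theorem norm_sum_sq_eq {ι : Type*} (s : Finset ι) (z : ι → ℂ) :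
    ((‖∑ i ∈ s, z i‖ ^ 2 : ℝ) : ℂ) = ∑ i ∈ s, ∑ j ∈ s, z i * (starRingEnd ℂ) (z j) := by
  push_cast
  rw [← Complex.mul_conj', map_sum, Finset.sum_mul_sum]

/-- Shifting by `min i j` turns the correlation into one at lag `|i - j|`, with boundary error at
most `2H`. The indicators encode the lag, so that summing over `i, j` reduces to counting pairs with
a given lag. -/
theorem norm_correlation_le {a : ℕ → ℂ} (ha : ∀ n, ‖a n‖ ≤ 1) {H : ℕ} (N : ℕ) {i j : ℕ}
    (hi : i < H) (hj : j < H) :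
    ‖∑ n ∈ Finset.Icc 1 N, a (n + i) * (starRingEnd ℂ) (a (n + j))‖ ≤
      2 * H + (if i = j then (N : ℝ) else 0) +
      ∑ d ∈ Finset.Icc 1 H, ((if j = i + d then 1 else 0) + (if i = j + d then 1 else 0)) *
        ‖∑ n ∈ Finset.Icc 1 N, a n * (starRingEnd ℂ) (a (n + d))‖ := by
  have hH : (0 : ℝ) ≤ H := H.cast_nonneg
  have hpos : ∀ d ∈ Finset.Icc 1 H, (0 : ℝ) ≤
      ((if j = i + d then 1 else 0) + (if i = j + d then 1 else 0)) *
        ‖∑ n ∈ Finset.Icc 1 N, a n * (starRingEnd ℂ) (a (n + d))‖ := by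
    intro d _
    positivity
  have key : ∀ i d : ℕ, i < H →
      ‖∑ n ∈ Finset.Icc 1 N, a (n + i) * (starRingEnd ℂ) (a (n + (i + d)))‖ ≤
      2 * H + ‖∑ n ∈ Finset.Icc 1 N, a n * (starRingEnd ℂ) (a (n + d))‖ := by
    intro i d hi
    have h1 := norm_sum_shift_sub_le (b := fun n => a n * (starRingEnd ℂ) (a (n + d)))
      (fun n => by
        rw [norm_mul, RCLike.norm_conj]
        exact mul_le_one₀ (ha _) (norm_nonneg _) (ha _)) N i
    simp only [add_assoc] at h1
    have h2 : (i : ℝ) ≤ H := by exact_mod_cast hi.le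
    have h3 := norm_le_norm_add_norm_sub'
      (∑ n ∈ Finset.Icc 1 N, a (n + i) * (starRingEnd ℂ) (a (n + (i + d))))
      (∑ n ∈ Finset.Icc 1 N, a n * (starRingEnd ℂ) (a (n + d)))
    linarith
  rcases lt_trichotomy i j with h | rfl | h
  · obtain ⟨d, rfl⟩ := Nat.exists_eq_add_of_lt h
    have hd : d + 1 ∈ Finset.Icc 1 H := by simp; omega
    have h1 := Finset.single_le_sum hpos hd
    have h2 := key i (d + 1) hi
    simp only [← add_assoc, if_true] at h1 h2 ⊢
    rw [if_neg (by omega)] at *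
    linarith
  · rw [if_pos rfl]
    have h1 : ‖∑ n ∈ Finset.Icc 1 N, a (n + i) * (starRingEnd ℂ) (a (n + i))‖ ≤ N := by
      refine (norm_sum_le_of_le _ (f := fun n => a (n + i) * (starRingEnd ℂ) (a (n + i)))
        (n := fun _ => 1) (fun n _ => ?_)).trans (by simp)
      rw [norm_mul, RCLike.norm_conj]
      exact mul_le_one₀ (ha _) (norm_nonneg _) (ha _)
    have h2 := Finset.sum_nonneg hpos
    linarith
  · obtain ⟨d, rfl⟩ := Nat.exists_eq_add_of_lt h
    have hd : d + 1 ∈ Finset.Icc 1 H := by simp; omega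
    have h1 := Finset.single_le_sum hpos hd
    have h2 := key j (d + 1) hj
    have h3 : ‖∑ n ∈ Finset.Icc 1 N, a (n + (j + d + 1)) * (starRingEnd ℂ) (a (n + j))‖
        = ‖∑ n ∈ Finset.Icc 1 N, a (n + j) * (starRingEnd ℂ) (a (n + (j + (d + 1))))‖ := by
      rw [← RCLike.norm_conj, map_sum]
      congr 1
      refine Finset.sum_congr rfl fun n _ => ?_
      rw [map_mul, Complex.conj_conj, mul_comm]
      rfl
    rw [h3]
    simp only [← add_assoc, if_true] at h1 h2 ⊢
    rw [if_neg (by omega)] at *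
    linarith

/-- Expand the square and exchange sums: each lag `d` occurs for at most `H` pairs in each order,
whence the factor `2H`. -/
theorem sum_norm_sq_window_le {a : ℕ → ℂ} (ha : ∀ n, ‖a n‖ ≤ 1) (N H : ℕ) :
    ∑ n ∈ Finset.Icc 1 N, ‖∑ h ∈ Finset.range H, a (n + h)‖ ^ 2 ≤
      2 * H ^ 3 + H * N + 2 * H * ∑ d ∈ Finset.Icc 1 H,
        ‖∑ n ∈ Finset.Icc 1 N, a n * (starRingEnd ℂ) (a (n + d))‖ := by
  set Γ : ℕ → ℝ := fun d => ‖∑ n ∈ Finset.Icc 1 N, a n * (starRingEnd ℂ) (a (n + d))‖ with hΓ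
  have h1 : ((∑ n ∈ Finset.Icc 1 N, ‖∑ h ∈ Finset.range H, a (n + h)‖ ^ 2 : ℝ) : ℂ) =
      ∑ i ∈ Finset.range H, ∑ j ∈ Finset.range H,
        ∑ n ∈ Finset.Icc 1 N, a (n + i) * (starRingEnd ℂ) (a (n + j)) := by
    rw [Complex.ofReal_sum]
    simp_rw [norm_sum_sq_eq]
    rw [Finset.sum_comm]
    exact Finset.sum_congr rfl fun i _ => Finset.sum_comm
  have h2 : ∑ n ∈ Finset.Icc 1 N, ‖∑ h ∈ Finset.range H, a (n + h)‖ ^ 2 =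
      ‖∑ i ∈ Finset.range H, ∑ j ∈ Finset.range H,
        ∑ n ∈ Finset.Icc 1 N, a (n + i) * (starRingEnd ℂ) (a (n + j))‖ := by
    rw [← h1, Complex.norm_real, Real.norm_of_nonneg]
    exact Finset.sum_nonneg fun _ _ => by positivity
  have hone : ∀ u : ℕ, ∑ j ∈ Finset.range H, (if j = u then (1 : ℝ) else 0) ≤ 1 := by
    intro u
    rw [Finset.sum_ite_eq']
    split_ifs <;> norm_num
  rw [h2]
  calc _ ≤ ∑ i ∈ Finset.range H, ∑ j ∈ Finset.range H,
        ‖∑ n ∈ Finset.Icc 1 N, a (n + i) * (starRingEnd ℂ) (a (n + j))‖ :=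
        norm_sum_le_of_le _ fun i _ => norm_sum_le _ _
    _ ≤ ∑ i ∈ Finset.range H, ∑ j ∈ Finset.range H, (2 * H + (if i = j then (N : ℝ) else 0) +
      ∑ d ∈ Finset.Icc 1 H, ((if j = i + d then 1 else 0) + (if i = j + d then 1 else 0)) *
        Γ d) := by
        refine Finset.sum_le_sum fun i hi => Finset.sum_le_sum fun j hj => ?_
        exact norm_correlation_le ha N (Finset.mem_range.1 hi) (Finset.mem_range.1 hj)
    _ = 2 * H ^ 3 + H * N + ∑ d ∈ Finset.Icc 1 H,
        (∑ i ∈ Finset.range H, ∑ j ∈ Finset.range H, (if j = i + d then (1 : ℝ) else 0) +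
          ∑ j ∈ Finset.range H, ∑ i ∈ Finset.range H, (if i = j + d then (1 : ℝ) else 0)) * Γ d := by
        simp only [Finset.sum_add_distrib]
        congr 1
        · congr 1
          · simp; ring
          · rw [Finset.sum_congr rfl (g := fun _ => (N : ℝ))]
            · simp
            · intro i hi
              rw [Finset.sum_ite_eq, if_pos hi]
        · have h3 : ∀ i ∈ Finset.range H, ∑ j ∈ Finset.range H, ∑ d ∈ Finset.Icc 1 H,
              ((if j = i + d then 1 else 0) + (if i = j + d then 1 else 0)) * Γ d =
              ∑ d ∈ Finset.Icc 1 H, ∑ j ∈ Finset.range H,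
              ((if j = i + d then 1 else 0) + (if i = j + d then 1 else 0)) * Γ d :=
            fun i _ => Finset.sum_comm
          rw [Finset.sum_congr rfl h3, Finset.sum_comm]
          refine Finset.sum_congr rfl fun d _ => ?_
          simp only [← Finset.sum_mul, Finset.sum_add_distrib, add_mul]
          congr 2
          exact Finset.sum_comm
    _ ≤ 2 * H ^ 3 + H * N + ∑ d ∈ Finset.Icc 1 H, (2 * H) * Γ d := by
        gcongr with d hd
        have h4 : ∀ d, ∑ i ∈ Finset.range H, ∑ j ∈ Finset.range H,
            (if j = i + d then (1 : ℝ) else 0) ≤ H := by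
          intro d
          calc _ ≤ ∑ i ∈ Finset.range H, (1 : ℝ) := Finset.sum_le_sum fun i _ => hone _
            _ = H := by simp
        linarith [h4 d]
    _ = _ := by rw [← Finset.mul_sum]

/-- Van der Corput's inequality. -/
theorem vanDerCorput {a : ℕ → ℂ} (ha : ∀ n, ‖a n‖ ≤ 1) {N H : ℕ} (hN : 1 ≤ N) (hH : 1 ≤ H) :
    ‖(1 / (N : ℂ)) * ∑ n ∈ Finset.Icc 1 N, a n‖ ^ 2 ≤
      2 * (1 / H + 2 * H / N) + 8 * (H / N) ^ 2 + 4 / H * ∑ d ∈ Finset.Icc 1 H,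
        ‖(1 / (N : ℂ)) * ∑ n ∈ Finset.Icc 1 N, a n * (starRingEnd ℂ) (a (n + d))‖ := by
  have hN' : (0 : ℝ) < N := by exact_mod_cast hN
  have hH' : (0 : ℝ) < H := by exact_mod_cast hH
  set A := ‖∑ n ∈ Finset.Icc 1 N, a n‖ with hA
  set B := ‖∑ n ∈ Finset.Icc 1 N, ∑ h ∈ Finset.range H, a (n + h)‖ with hB
  -- Averaging over the `H` shifted copies of the sum changes it only by boundary terms.
  have h1 : H * A ≤ B + 2 * H ^ 2 := by
    have h2 : ‖∑ h ∈ Finset.range H, (∑ n ∈ Finset.Icc 1 N, a (n + h) -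
        ∑ n ∈ Finset.Icc 1 N, a n)‖ ≤ 2 * H ^ 2 := by
      calc _ ≤ ∑ h ∈ Finset.range H, (2 * H : ℝ) := norm_sum_le_of_le _ fun h hh =>
            (norm_sum_shift_sub_le ha N h).trans (by
              have : (h : ℝ) ≤ H := by exact_mod_cast (Finset.mem_range.1 hh).le
              linarith)
        _ = _ := by simp; ring
    rw [Finset.sum_sub_distrib, Finset.sum_comm, Finset.sum_const, Finset.card_range,
      norm_sub_rev] at h2
    have h3 := norm_le_norm_add_norm_sub' (H • ∑ n ∈ Finset.Icc 1 N, a n)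
      (∑ n ∈ Finset.Icc 1 N, ∑ h ∈ Finset.range H, a (n + h))
    have h4 : ‖H • ∑ n ∈ Finset.Icc 1 N, a n‖ = H * A := by
      rw [nsmul_eq_mul, norm_mul, Complex.norm_natCast]
    rw [h4] at h3
    linarith
  have h2 : B ^ 2 ≤ N * (2 * H ^ 3 + H * N + 2 * H * ∑ d ∈ Finset.Icc 1 H,
        ‖∑ n ∈ Finset.Icc 1 N, a n * (starRingEnd ℂ) (a (n + d))‖) := by
    have := norm_sum_sq_le_card_mul (Finset.Icc 1 N) (fun n => ∑ h ∈ Finset.range H, a (n + h))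
    rw [Nat.card_Icc, Nat.add_sub_cancel] at this
    exact this.trans (mul_le_mul_of_nonneg_left (sum_norm_sq_window_le ha N H) hN'.le)
  have h3 : (H * A) ^ 2 ≤ 2 * B ^ 2 + 8 * H ^ 4 := by
    have h4 : (H * A) ^ 2 ≤ (B + 2 * H ^ 2) ^ 2 := by gcongr
    nlinarith [sq_nonneg (B - 2 * (H : ℝ) ^ 2)]
  have h4 : ∀ z : ℂ, ‖(1 / (N : ℂ)) * z‖ = ‖z‖ / N := by
    intro z
    rw [norm_mul, norm_div, norm_one, Complex.norm_natCast]
    ring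
  simp only [h4, ← Finset.sum_div]
  set G := ∑ d ∈ Finset.Icc 1 H, ‖∑ n ∈ Finset.Icc 1 N, a n * (starRingEnd ℂ) (a (n + d))‖
  have h5 : (A / N) ^ 2 = (H * A) ^ 2 / (H ^ 2 * N ^ 2) := by field_simp
  rw [h5]
  calc (H * A) ^ 2 / ((H : ℝ) ^ 2 * N ^ 2)
      ≤ (2 * (N * (2 * H ^ 3 + H * N + 2 * H * G)) + 8 * H ^ 4) / ((H : ℝ) ^ 2 * N ^ 2) := by
        gcongr
        linarith
    _ = _ := by field_simp; ring

theorem one_div_natSqrt_le {N : ℕ} (hN : 1 ≤ N) :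
    1 / (Nat.sqrt N : ℝ) ≤ 2 / Real.sqrt N := by
  have h1 : 1 ≤ Nat.sqrt N := Nat.sqrt_pos.2 hN
  have h1' : (1 : ℝ) ≤ Nat.sqrt N := by exact_mod_cast h1
  have h2 := Real.real_sqrt_lt_nat_sqrt_succ (a := N)
  have h3 : 0 < Real.sqrt N := Real.sqrt_pos.2 (by exact_mod_cast hN)
  rw [div_le_div_iff₀ (by linarith) h3]
  linarith

/-- Van der Corput's inequality with `H = ⌊√N⌋`, whose right side no longer depends on `t`. Since
`1/H ≤ 2/√N`, the error terms add up to `(4 + 4 + 8)/√N`. -/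
theorem trigSup_sq_le {u : ℕ → ℂ} (hu : ∀ n, ‖u n‖ ≤ 1) {N : ℕ} (hN : 1 ≤ N) :
    trigSup N u ^ 2 ≤ 16 / Real.sqrt N + 4 / (Nat.sqrt N : ℝ) *
      ∑ d ∈ Finset.Icc 1 (Nat.sqrt N),
        ‖(1 / (N : ℂ)) * ∑ n ∈ Finset.Icc 1 N, u n * (starRingEnd ℂ) (u (n + d))‖ := by
  have hN' : (1 : ℝ) ≤ N := by exact_mod_cast hN
  have hs1 : 1 ≤ Real.sqrt N := Real.one_le_sqrt.2 hN'
  have hs2 : Real.sqrt N ^ 2 = N := Real.sq_sqrt (by linarith)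
  have hH : 1 ≤ Nat.sqrt N := Nat.sqrt_pos.2 hN
  have hHs := Real.nat_sqrt_le_real_sqrt (a := N)
  set D := 16 / Real.sqrt N + 4 / (Nat.sqrt N : ℝ) *
      ∑ d ∈ Finset.Icc 1 (Nat.sqrt N),
        ‖(1 / (N : ℂ)) * ∑ n ∈ Finset.Icc 1 N, u n * (starRingEnd ℂ) (u (n + d))‖ with hD
  have hD0 : 0 ≤ D := by positivity
  have h1 : trigSup N u ≤ Real.sqrt D := by
    refine ciSup_le fun t => Real.le_sqrt_of_sq_le ?_
    have hv := vanDerCorput (a := fun n => Complex.exp (2 * Real.pi * Complex.I * n * t) * u n)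
      (fun n => by rw [norm_mul, norm_exp_two_pi_mul, one_mul]; exact hu n) hN hH
    -- The product of `e^{2πint}` with the conjugate of `e^{2πi(n+d)t}` is a unimodular constant
    -- independent of `n`, so the modulus forgets `t`.
    have heq : ∀ d, ‖(1 / (N : ℂ)) * ∑ n ∈ Finset.Icc 1 N,
        Complex.exp (2 * Real.pi * Complex.I * n * t) * u n * (starRingEnd ℂ)
          (Complex.exp (2 * Real.pi * Complex.I * (n + d : ℕ) * t) * u (n + d))‖ =
        ‖(1 / (N : ℂ)) * ∑ n ∈ Finset.Icc 1 N, u n * (starRingEnd ℂ) (u (n + d))‖ := by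
      intro d
      have : ∀ n : ℕ, Complex.exp (2 * Real.pi * Complex.I * n * t) * u n * (starRingEnd ℂ)
          (Complex.exp (2 * Real.pi * Complex.I * (n + d : ℕ) * t) * u (n + d)) =
          (starRingEnd ℂ) (Complex.exp (2 * Real.pi * Complex.I * d * t)) *
            (u n * (starRingEnd ℂ) (u (n + d))) := by
        intro n
        have h1 : Complex.exp (2 * Real.pi * Complex.I * (n + d : ℕ) * t) =
            Complex.exp (2 * Real.pi * Complex.I * n * t) *
            Complex.exp (2 * Real.pi * Complex.I * d * t) := by
          rw [← Complex.exp_add]; push_cast; ring_nf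
        have h2 : Complex.exp (2 * Real.pi * Complex.I * n * t) *
            (starRingEnd ℂ) (Complex.exp (2 * Real.pi * Complex.I * n * t)) = 1 := by
          rw [Complex.mul_conj', norm_exp_two_pi_mul]; simp
        rw [h1, map_mul, map_mul]
        linear_combination (u n * (starRingEnd ℂ) (u (n + d)) *
          (starRingEnd ℂ) (Complex.exp (2 * Real.pi * Complex.I * d * t))) * h2
      simp_rw [this, ← Finset.mul_sum]
      rw [mul_left_comm, norm_mul, RCLike.norm_conj, norm_exp_two_pi_mul, one_mul]
    simp only [heq] at hv
    refine hv.trans ?_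
    rw [hD]
    have e1 := one_div_natSqrt_le hN
    have e2 : (Nat.sqrt N : ℝ) / N ≤ 1 / Real.sqrt N := by
      rw [div_le_div_iff₀ (by linarith) (by linarith)]
      nlinarith
    have e3 : ((Nat.sqrt N : ℝ) / N) ^ 2 ≤ 1 / Real.sqrt N := by
      have : 1 / Real.sqrt N ≤ 1 := by rw [div_le_one (by linarith)]; exact hs1
      calc ((Nat.sqrt N : ℝ) / N) ^ 2 ≤ (1 / Real.sqrt N) ^ 2 := by gcongr
        _ ≤ 1 / Real.sqrt N := pow_le_of_le_one (by positivity) this two_ne_zero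
    have e4 : 2 * (1 / (Nat.sqrt N : ℝ) + 2 * Nat.sqrt N / N) + 8 * (Nat.sqrt N / N) ^ 2 ≤
        16 / Real.sqrt N := by
      have : 2 / Real.sqrt N = 2 * (1 / Real.sqrt N) := by ring
      have : 16 / Real.sqrt N = 16 * (1 / Real.sqrt N) := by ring
      have : 2 * (Nat.sqrt N : ℝ) / N = 2 * (Nat.sqrt N / N) := by ring
      linarith
    linarith
  calc trigSup N u ^ 2 ≤ Real.sqrt D ^ 2 := by
        gcongr
        exact trigSup_nonneg N u
    _ = D := Real.sq_sqrt hD0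

/-! ### Fourier analysis on `ℤ/L` -/

/-- Orthogonality of characters: off the diagonal this is a geometric sum whose ratio `x ≠ 1`
satisfies `x ^ L = 1`. -/
theorem sum_primitiveRoot_mul_conj {ζ : ℂ} {L : ℕ} (hL : L ≠ 0) (hζ : IsPrimitiveRoot ζ L)
    (n m : ℕ) : ∑ j ∈ Finset.range L, ζ ^ (j * n) * (starRingEnd ℂ) (ζ ^ (j * m)) =
      if n % L = m % L then (L : ℂ) else 0 := by
  have hnorm : ∀ k : ℕ, ζ ^ k * (starRingEnd ℂ) (ζ ^ k) = 1 := by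
    intro k
    rw [Complex.mul_conj', norm_pow, hζ.norm'_eq_one hL]
    simp
  have hmod : ∀ k : ℕ, ζ ^ (k % L) = ζ ^ k := fun k => by
    conv_lhs => rw [hζ.eq_orderOf]
    exact pow_mod_orderOf ζ k
  have hterm : ∀ j, ζ ^ (j * n) * (starRingEnd ℂ) (ζ ^ (j * m)) =
      (ζ ^ n * (starRingEnd ℂ) (ζ ^ m)) ^ j := by
    intro j
    rw [mul_pow, ← map_pow, ← pow_mul, ← pow_mul, mul_comm n, mul_comm m]
  simp_rw [hterm]
  split_ifs with h
  · have : ζ ^ n = ζ ^ m := by rw [← hmod n, h, hmod m]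
    rw [this, hnorm]
    simp
  · set x := ζ ^ n * (starRingEnd ℂ) (ζ ^ m) with hx
    have hx1 : x ≠ 1 := by
      intro hx1
      apply h
      have e : ζ ^ n = ζ ^ m := by
        linear_combination (-ζ ^ n) * hnorm m + ζ ^ m * (hx.symm.trans hx1)
      rw [← hmod n, ← hmod m] at e
      exact hζ.pow_inj (Nat.mod_lt _ (Nat.pos_of_ne_zero hL)) (Nat.mod_lt _ (Nat.pos_of_ne_zero hL)) e
    have hxL : x ^ L = 1 := by
      rw [hx, mul_pow, ← map_pow, ← pow_mul, ← pow_mul, mul_comm n, mul_comm m, pow_mul, pow_mul,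
        hζ.pow_eq_one]
      simp
    have := mul_geom_sum x L
    rw [hxL, sub_self] at this
    exact (mul_eq_zero.1 this).resolve_left (sub_ne_zero.2 hx1)

/-- Parseval's identity on `ℤ/L`. -/
theorem sum_norm_sq_dft {ζ : ℂ} {L : ℕ} (hL : L ≠ 0) (hζ : IsPrimitiveRoot ζ L) (s : Finset ℕ)
    (hs : ∀ n ∈ s, ∀ m ∈ s, n % L = m % L → n = m) (c : ℕ → ℂ) :
    ∑ j ∈ Finset.range L, ‖∑ n ∈ s, ζ ^ (j * n) * c n‖ ^ 2 = L * ∑ n ∈ s, ‖c n‖ ^ 2 := by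
  apply Complex.ofReal_injective
  rw [Complex.ofReal_sum]
  simp_rw [norm_sum_sq_eq]
  rw [Finset.sum_comm]
  push_cast
  rw [Finset.mul_sum]
  refine Finset.sum_congr rfl fun n hn => ?_
  rw [Finset.sum_comm, Finset.sum_eq_single_of_mem n hn]
  · have := sum_primitiveRoot_mul_conj hL hζ n n
    rw [if_pos rfl] at this
    rw [← this, Finset.sum_mul]
    refine Finset.sum_congr rfl fun j _ => ?_
    rw [map_mul, ← Complex.mul_conj']
    ring
  · intro m hm hmn
    have := sum_primitiveRoot_mul_conj hL hζ n m
    rw [if_neg fun h => hmn (hs n hn m hm h).symm] at this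
    calc _ = (∑ j ∈ Finset.range L, ζ ^ (j * n) * (starRingEnd ℂ) (ζ ^ (j * m))) *
          (c n * (starRingEnd ℂ) (c m)) := by
          rw [Finset.sum_mul]
          refine Finset.sum_congr rfl fun j _ => ?_
          rw [map_mul]
          ring
      _ = 0 := by rw [this, zero_mul]

theorem mod_injOn_Icc (L : ℕ) : ∀ n ∈ Finset.Icc 1 L, ∀ m ∈ Finset.Icc 1 L,
    n % L = m % L → n = m := by
  intro n hn m hm h
  rw [Finset.mem_Icc] at hn hm
  rcases hn.2.lt_or_eq with h1 | h1 <;> rcases hm.2.lt_or_eq with h2 | h2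
  · rwa [Nat.mod_eq_of_lt h1, Nat.mod_eq_of_lt h2] at h
  · rw [Nat.mod_eq_of_lt h1, h2, Nat.mod_self] at h; omega
  · rw [Nat.mod_eq_of_lt h2, h1, Nat.mod_self] at h; omega
  · omega

theorem exp_root_pow {L : ℕ} (j n : ℕ) :
    Complex.exp (2 * Real.pi * Complex.I / L) ^ (j * n) =
      Complex.exp (2 * Real.pi * Complex.I * n * ((j / L : ℝ) : ℂ)) := by
  rw [← Complex.exp_nat_mul]
  push_cast
  ring_nf

/-- A convolution with `c` is bounded on `ℓ²` by the supremum of the trigonometric polynomial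
with coefficients `c`. -/
theorem sum_norm_sq_convolution_le {c : ℕ → ℂ} {N : ℕ} {M : ℝ}
    (hc : ∀ t : ℝ, ‖∑ n ∈ Finset.Icc 1 N,
      Complex.exp (2 * Real.pi * Complex.I * n * t) * c n‖ ≤ M) (b : ℕ → ℂ) (K : ℕ) :
    ∑ m ∈ Finset.range K, ‖∑ n ∈ Finset.Icc 1 N, c n * b (n + m)‖ ^ 2 ≤
      M ^ 2 * ∑ l ∈ Finset.Icc 1 (N + K), ‖b l‖ ^ 2 := by
  rcases Nat.eq_zero_or_pos (N + K) with h0 | hpos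
  · have : K = 0 := by omega
    subst this
    simp only [Finset.range_zero, Finset.sum_empty]
    positivity
  -- With this length the indices `n + m` stay in `[1, L]`, so the cyclic correlation never wraps
  -- around.
  set L := N + K with hLdef
  have hL : L ≠ 0 := hpos.ne'
  have hL' : (0 : ℝ) < L := by exact_mod_cast hpos
  set ζ := Complex.exp (2 * Real.pi * Complex.I / L) with hζdef
  have hζ : IsPrimitiveRoot ζ L := Complex.isPrimitiveRoot_exp L hL
  set p : ℕ → ℂ := fun j => ∑ n ∈ Finset.Icc 1 N, ζ ^ (j * n) * c n with hp
  set q : ℕ → ℂ := fun j => ∑ l ∈ Finset.Icc 1 L, ζ ^ (j * l) * (starRingEnd ℂ) (b l) with hq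
  have hpM : ∀ j, ‖p j‖ ≤ M := by
    intro j
    have := hc (j / L : ℝ)
    simpa only [hp, hζdef, exp_root_pow] using this
  have hqsum : ∑ j ∈ Finset.range L, ‖q j‖ ^ 2 = L * ∑ l ∈ Finset.Icc 1 L, ‖b l‖ ^ 2 := by
    rw [hq, sum_norm_sq_dft hL hζ _ (mod_injOn_Icc L)]
    simp
  -- On the Fourier side the correlation is the pointwise product `p · conj q`; orthogonality
  -- selects `l = n + m`.
  have hcoef : ∀ m ∈ Finset.range K, ∑ j ∈ Finset.range L, ζ ^ (m * j) *
      (p j * (starRingEnd ℂ) (q j)) = L * ∑ n ∈ Finset.Icc 1 N, c n * b (n + m) := by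
    intro m hm
    have hm' := Finset.mem_range.1 hm
    have h1 : ∀ j, ζ ^ (m * j) * (p j * (starRingEnd ℂ) (q j)) =
        ∑ n ∈ Finset.Icc 1 N, ∑ l ∈ Finset.Icc 1 L,
          (c n * b l) * (ζ ^ (j * (n + m)) * (starRingEnd ℂ) (ζ ^ (j * l))) := by
      intro j
      simp only [hp, hq, map_sum, Finset.sum_mul_sum]
      rw [Finset.mul_sum]
      refine Finset.sum_congr rfl fun n _ => ?_
      rw [Finset.mul_sum]
      refine Finset.sum_congr rfl fun l _ => ?_
      rw [map_mul, Complex.conj_conj, mul_add, pow_add, mul_comm m j]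
      ring
    simp_rw [h1]
    rw [Finset.sum_comm, Finset.mul_sum]
    refine Finset.sum_congr rfl fun n hn => ?_
    rw [Finset.sum_comm]
    simp_rw [← Finset.mul_sum, sum_primitiveRoot_mul_conj hL hζ]
    have hmem : n + m ∈ Finset.Icc 1 L := by
      rw [Finset.mem_Icc] at hn ⊢
      omega
    rw [Finset.sum_eq_single_of_mem (n + m) hmem]
    · rw [if_pos rfl]; ring
    · intro l hl hne
      rw [if_neg fun h => hne (mod_injOn_Icc L _ hmem _ hl h).symm, mul_zero]
  -- Parseval again, now summing over frequencies `j`; below, the coefficients with `K ≤ m < L` are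
  -- discarded.
  have hdual := sum_norm_sq_dft hL hζ (Finset.range L) (fun n hn m hm h => by
    rwa [Nat.mod_eq_of_lt (Finset.mem_range.1 hn), Nat.mod_eq_of_lt (Finset.mem_range.1 hm)] at h)
    (fun j => p j * (starRingEnd ℂ) (q j))
  have h2 : ∑ m ∈ Finset.range K, (L : ℝ) ^ 2 * ‖∑ n ∈ Finset.Icc 1 N, c n * b (n + m)‖ ^ 2 ≤
      L * ∑ j ∈ Finset.range L, ‖p j * (starRingEnd ℂ) (q j)‖ ^ 2 := by
    rw [← hdual]
    calc _ = ∑ m ∈ Finset.range K, ‖∑ j ∈ Finset.range L, ζ ^ (m * j) *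
          (p j * (starRingEnd ℂ) (q j))‖ ^ 2 := by
          refine Finset.sum_congr rfl fun m hm => ?_
          rw [hcoef m hm, norm_mul, Complex.norm_natCast, mul_pow]
      _ ≤ _ := Finset.sum_le_sum_of_subset_of_nonneg
          (Finset.range_subset_range.2 (by omega)) fun _ _ _ => by positivity
  have h3 : ∑ j ∈ Finset.range L, ‖p j * (starRingEnd ℂ) (q j)‖ ^ 2 ≤
      M ^ 2 * (L * ∑ l ∈ Finset.Icc 1 L, ‖b l‖ ^ 2) := by
    rw [← hqsum, Finset.mul_sum]
    refine Finset.sum_le_sum fun j _ => ?_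
    rw [norm_mul, RCLike.norm_conj, mul_pow]
    have := hpM j
    gcongr
  rw [← Finset.mul_sum] at h2
  have h4 : (L : ℝ) ^ 2 * ∑ m ∈ Finset.range K, ‖∑ n ∈ Finset.Icc 1 N, c n * b (n + m)‖ ^ 2 ≤
      (L : ℝ) ^ 2 * (M ^ 2 * ∑ l ∈ Finset.Icc 1 L, ‖b l‖ ^ 2) := by
    calc _ ≤ _ := h2
      _ ≤ L * (M ^ 2 * (L * ∑ l ∈ Finset.Icc 1 L, ‖b l‖ ^ 2)) := by gcongr
      _ = _ := by ring
  exact le_of_mul_le_mul_left h4 (by positivity)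

/-- The supremum dominates the values at the frequencies `j/N`, whose mean square is given by
Parseval. -/
theorem sum_norm_sq_le_trigSup_sq {N : ℕ} (hN : 1 ≤ N) (c : ℕ → ℂ) :
    1 / (N : ℝ) ^ 2 * ∑ n ∈ Finset.Icc 1 N, ‖c n‖ ^ 2 ≤ trigSup N c ^ 2 := by
  have hN' : (0 : ℝ) < N := by exact_mod_cast hN
  have hN0 : N ≠ 0 := by omega
  have h := sum_norm_sq_dft hN0 (Complex.isPrimitiveRoot_exp N hN0) _ (mod_injOn_Icc N) c
  have h1 : ∀ j ∈ Finset.range N, ‖∑ n ∈ Finset.Icc 1 N,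
      Complex.exp (2 * Real.pi * Complex.I / N) ^ (j * n) * c n‖ ^ 2 ≤ (N * trigSup N c) ^ 2 := by
    intro j _
    have := norm_trigAverage_le_trigSup N c (j / N : ℝ)
    rw [norm_mul, norm_div, norm_one, Complex.norm_natCast, one_div, inv_mul_le_iff₀ hN'] at this
    simp only [exp_root_pow]
    exact pow_le_pow_left₀ (norm_nonneg _) this 2
  have h2 := Finset.sum_le_sum h1
  rw [h, Finset.sum_const, Finset.card_range, nsmul_eq_mul] at h2
  have h3 := le_of_mul_le_mul_left h2 hN'
  rw [mul_pow] at h3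
  rw [one_div, inv_mul_le_iff₀ (by positivity)]
  exact h3

/-! ### Koopman operators -/

theorem integrable_of_norm_le {X E : Type*} [MeasurableSpace X] [NormedAddCommGroup E]
    {μ : Measure X} [IsFiniteMeasure μ] {f : X → E}
    (hf : AEStronglyMeasurable f μ) {C : ℝ} (hC : ∀ x, ‖f x‖ ≤ C) : Integrable f μ :=
  Integrable.of_bound hf C (ae_of_all _ hC)

theorem integral_comp_measurePreserving {X Y : Type*} [MeasurableSpace X] [MeasurableSpace Y]
    {μ : Measure X} {ν : Measure Y} {T : X → Y} (hT : MeasurePreserving T μ ν) {f : Y → ℝ}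
    (hf : Measurable f) : ∫ x, f (T x) ∂μ = ∫ y, f y ∂ν := by
  rw [← hT.map_eq, integral_map hT.measurable.aemeasurable hf.aestronglyMeasurable]

/-- Von Neumann's inequality for polynomials in a Koopman operator. -/
theorem integral_norm_sq_orbit_sum_le {Y : Type*} [MeasurableSpace Y] {ν : Measure Y}
    [IsProbabilityMeasure ν] {S : Y → Y} (hS : MeasurePreserving S ν ν) {G : Y → ℂ}
    (hG : Measurable G) (hG1 : ∀ y, ‖G y‖ ≤ 1) {c : ℕ → ℂ} {N : ℕ} {M : ℝ}
    (hc : ∀ t : ℝ, ‖∑ n ∈ Finset.Icc 1 N,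
      Complex.exp (2 * Real.pi * Complex.I * n * t) * c n‖ ≤ M) :
    ∫ y, ‖∑ n ∈ Finset.Icc 1 N, c n * G (S^[n] y)‖ ^ 2 ∂ν ≤ M ^ 2 := by
  set φ : Y → ℝ := fun y => ‖∑ n ∈ Finset.Icc 1 N, c n * G (S^[n] y)‖ ^ 2 with hφ
  have hGS : ∀ n, Measurable fun y => G (S^[n] y) := fun n => hG.comp (hS.measurable.iterate n)
  have hφm : Measurable φ :=
    ((Finset.measurable_sum _ fun n _ => (hGS n).const_mul _).norm).pow_const 2
  have hφb : ∀ y, ‖φ y‖ ≤ (∑ n ∈ Finset.Icc 1 N, ‖c n‖) ^ 2 := by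
    intro y
    rw [hφ, Real.norm_of_nonneg (by positivity)]
    refine pow_le_pow_left₀ (norm_nonneg _) ?_ 2
    refine norm_sum_le_of_le _ fun n _ => ?_
    rw [norm_mul]
    exact mul_le_of_le_one_right (norm_nonneg _) (hG1 _)
  have hφi : ∀ m, Integrable (fun y => φ (S^[m] y)) ν := fun m =>
    integrable_of_norm_le (hφm.comp (hS.measurable.iterate m)).aestronglyMeasurable fun y => hφb _
  -- By invariance the integral may be averaged over the shifts `S^[m]`, `m < K`. Along each orbit
  -- this is a convolution, bounded on `ℓ²` by `M`. No invertibility of `S` is needed.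
  have key : ∀ K : ℕ, K * ∫ y, φ y ∂ν ≤ M ^ 2 * (N + K) := by
    intro K
    calc K * ∫ y, φ y ∂ν = ∑ m ∈ Finset.range K, ∫ y, φ (S^[m] y) ∂ν := by
          simp_rw [integral_comp_measurePreserving (hS.iterate _) hφm]
          simp
      _ = ∫ y, ∑ m ∈ Finset.range K, φ (S^[m] y) ∂ν :=
          (integral_finsetSum _ fun m _ => hφi m).symm
      _ ≤ ∫ y, M ^ 2 * (N + K) ∂ν := by
          refine integral_mono (integrable_finsetSum _ fun m _ => hφi m) (integrable_const _) ?_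
          intro y
          have h1 := sum_norm_sq_convolution_le hc (fun l => G (S^[l] y)) K
          have h2 : ∑ l ∈ Finset.Icc 1 (N + K), ‖G (S^[l] y)‖ ^ 2 ≤ N + K := by
            calc _ ≤ ∑ l ∈ Finset.Icc 1 (N + K), (1 : ℝ) :=
                  Finset.sum_le_sum fun l _ => pow_le_one₀ (norm_nonneg _) (hG1 _)
              _ = _ := by simp
          simp only [hφ, ← Function.iterate_add_apply]
          exact h1.trans (by gcongr)
      _ = _ := by simp
  -- Dividing by `K` and letting `K → ∞` removes the boundary contribution `M² N / K`.
  by_contra! hlt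
  obtain ⟨K, hK⟩ := exists_nat_gt (M ^ 2 * N / (∫ y, φ y ∂ν - M ^ 2))
  rw [div_lt_iff₀ (by linarith)] at hK
  linarith [key K]

/-! ### Basic properties of the Wiener-Wintner averages -/

/-- The multiplicative derivative `f · conj(f ∘ T^h)`. -/
noncomputable def mulDeriv {X : Type*} (T : X → X) (h : ℕ) (f : X → ℂ) : X → ℂ :=
  fun x => f x * (starRingEnd ℂ) (f (T^[h] x))

theorem wwAvg_add_two {X : Type*} [MeasurableSpace X] (μ : Measure X) (T : X → X) (N k : ℕ)
    (f : X → ℂ) : wwAvg μ T N (k + 2) f = (1 / (Nat.sqrt N : ℝ)) *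
      ∑ h ∈ Finset.Icc 1 (Nat.sqrt N), wwAvg μ T N (k + 1) (mulDeriv T h f) := rfl

theorem norm_mulDeriv_le_one {X : Type*} {T : X → X} {f : X → ℂ} (hf : ∀ x, ‖f x‖ ≤ 1) (h : ℕ)
    (x : X) : ‖mulDeriv T h f x‖ ≤ 1 := by
  rw [mulDeriv, norm_mul, RCLike.norm_conj]
  exact mul_le_one₀ (hf _) (norm_nonneg _) (hf _)

theorem measurable_mulDeriv {X : Type*} [MeasurableSpace X] {T : X → X} (hT : Measurable T)
    {f : X → ℂ} (hf : Measurable f) (h : ℕ) : Measurable (mulDeriv T h f) :=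
  hf.mul (Complex.continuous_conj.measurable.comp (hf.comp (hT.iterate h)))

theorem average_le_of_le {H : ℕ} {a : ℕ → ℝ} {M : ℝ} (hM : 0 ≤ M) (ha : ∀ h, a h ≤ M) :
    1 / (H : ℝ) * ∑ h ∈ Finset.Icc 1 H, a h ≤ M := by
  rcases Nat.eq_zero_or_pos H with rfl | hH
  · simpa using hM
  have hH' : (0 : ℝ) < H := by exact_mod_cast hH
  rw [one_div, inv_mul_le_iff₀ hH']
  calc _ ≤ ∑ h ∈ Finset.Icc 1 H, M := Finset.sum_le_sum fun h _ => ha h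
    _ = _ := by simp

theorem wwAvg_nonneg {X : Type*} [MeasurableSpace X] (μ : Measure X) (T : X → X) (N : ℕ) :
    ∀ (k : ℕ) (f : X → ℂ), 0 ≤ wwAvg μ T N k f
  | 0, _ => le_rfl
  | 1, _ => Real.rpow_nonneg ENNReal.toReal_nonneg _
  | k + 2, f => by
    rw [wwAvg_add_two]
    exact mul_nonneg (by positivity) (Finset.sum_nonneg fun h _ => wwAvg_nonneg μ T N (k + 1) _)

theorem wwSup_nonneg {X : Type*} (T : X → X) (N : ℕ) (f : X → ℂ) (x : X) : 0 ≤ wwSup T N f x :=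
  trigSup_nonneg _ _

theorem wwSup_le_one {X : Type*} {T : X → X} {f : X → ℂ} (hf : ∀ x, ‖f x‖ ≤ 1) (N : ℕ) (x : X) :
    wwSup T N f x ≤ 1 :=
  trigSup_le zero_le_one fun _ => hf _

theorem wwAvg_le_one {X : Type*} [MeasurableSpace X] (μ : Measure X) [IsProbabilityMeasure μ]
    (T : X → X) (N : ℕ) : ∀ (k : ℕ) {f : X → ℂ}, (∀ x, ‖f x‖ ≤ 1) → wwAvg μ T N k f ≤ 1
  | 0, _, _ => zero_le_one
  | 1, f, hf => by
    refine Real.rpow_le_one ENNReal.toReal_nonneg ?_ (by norm_num)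
    refine ENNReal.toReal_le_of_le_ofReal zero_le_one ?_
    have := eLpNorm_le_of_ae_bound (p := 2) (μ := μ) (f := wwSup T N f) (C := 1)
      (ae_of_all _ fun x => by
        rw [Real.norm_of_nonneg (wwSup_nonneg _ _ _ _)]; exact wwSup_le_one hf N x)
    simpa using this
  | k + 2, f, hf => by
    rw [wwAvg_add_two]
    exact average_le_of_le zero_le_one fun h =>
      wwAvg_le_one μ T N (k + 1) (norm_mulDeriv_le_one hf h)

theorem ae_eq_comp_iterate {X : Type*} [MeasurableSpace X] {μ : Measure X} {T : X → X}
    (hT : MeasurePreserving T μ μ) {f g : X → ℂ} (h : f =ᵐ[μ] g) (n : ℕ) :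
    (fun x => f (T^[n] x)) =ᵐ[μ] fun x => g (T^[n] x) :=
  (hT.iterate n).quasiMeasurePreserving.ae_eq_comp h

/-- The supremum at `x` sees the whole orbit, but preimages of a null set under the countably many
iterates are still null. -/
theorem wwAvg_congr_ae {X : Type*} [MeasurableSpace X] {μ : Measure X} {T : X → X}
    (hT : MeasurePreserving T μ μ) (N : ℕ) :
    ∀ (k : ℕ) {f g : X → ℂ}, f =ᵐ[μ] g → wwAvg μ T N k f = wwAvg μ T N k g
  | 0, _, _, _ => rfl
  | 1, f, g, h => by
    have : wwSup T N f =ᵐ[μ] wwSup T N g := by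
      filter_upwards [ae_all_iff.2 (ae_eq_comp_iterate hT h)] with x hx
      simp only [wwSup, hx]
    simp only [wwAvg]
    rw [eLpNorm_congr_ae this]
  | k + 2, f, g, h => by
    simp only [wwAvg_add_two]
    congr 1
    refine Finset.sum_congr rfl fun d _ => wwAvg_congr_ae hT N (k + 1) ?_
    filter_upwards [h, ae_eq_comp_iterate hT h d] with x h1 h2
    simp only [mulDeriv, h1, h2]

theorem wwSup_const_mul {X : Type*} (T : X → X) (N : ℕ) (c : ℂ) (f : X → ℂ) :
    wwSup T N (fun x => c * f x) = fun x => ‖c‖ * wwSup T N f x := by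
  funext x
  simp only [wwSup, Real.mul_iSup_of_nonneg (norm_nonneg c), ← norm_mul]
  congr 1
  funext t
  congr 1
  rw [Finset.mul_sum, Finset.mul_sum, Finset.mul_sum]
  exact Finset.sum_congr rfl fun n _ => by ring

/-- Order 1 has degree `2/3`, and each multiplicative derivative replaces `c` by `c · conj c`,
doubling the degree. -/
theorem wwAvg_const_mul {X : Type*} [MeasurableSpace X] (μ : Measure X) (T : X → X) (N : ℕ) :
    ∀ (k : ℕ) (c : ℂ) (f : X → ℂ), wwAvg μ T N (k + 1) (fun x => c * f x) =
      ‖c‖ ^ (2 / 3 * 2 ^ k : ℝ) * wwAvg μ T N (k + 1) f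
  | 0, c, f => by
    simp only [wwAvg, wwSup_const_mul]
    have : (fun x => ‖c‖ * wwSup T N f x) = ‖c‖ • wwSup T N f := rfl
    rw [this, eLpNorm_const_smul, ENNReal.toReal_mul, Real.mul_rpow ENNReal.toReal_nonneg
      ENNReal.toReal_nonneg]
    simp
  | k + 1, c, f => by
    simp only [wwAvg_add_two]
    have h1 : ∀ h, mulDeriv T h (fun x => c * f x) =
        fun x => (c * (starRingEnd ℂ) c) * mulDeriv T h f x := by
      intro h
      funext x
      simp only [mulDeriv, map_mul]
      ring
    simp_rw [h1, wwAvg_const_mul μ T N k]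
    rw [← Finset.mul_sum, mul_left_comm, norm_mul, RCLike.norm_conj, ← sq, ← Real.rpow_natCast,
      ← Real.rpow_mul (norm_nonneg _)]
    congr 2
    push_cast
    ring

theorem wwAvg_comp_measurableEquiv {X Y : Type*} [MeasurableSpace X] [MeasurableSpace Y]
    {μ : Measure X} {ν : Measure Y} {T : X → X} {S : Y → Y} (e : X ≃ᵐ Y)
    (he : MeasurePreserving e μ ν) (h : Function.Semiconj e T S) (N : ℕ) :
    ∀ (k : ℕ) (f : Y → ℂ), wwAvg μ T N k (fun x => f (e x)) = wwAvg ν S N k f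
  | 0, _ => rfl
  | 1, f => by
    simp only [wwAvg]
    have : wwSup T N (fun x => f (e x)) = wwSup S N f ∘ e := by
      funext x
      simp only [wwSup, Function.comp_apply, (h.iterate_right _).eq]
    rw [this, ← he.map_eq, e.measurableEmbedding.eLpNorm_map_measure]
  | k + 2, f => by
    simp only [wwAvg_add_two]
    congr 1
    refine Finset.sum_congr rfl fun d _ => ?_
    rw [← wwAvg_comp_measurableEquiv e he h N (k + 1)]
    congr 1
    funext x
    simp only [mulDeriv, (h.iterate_right _).eq]

theorem measurable_wwSup {X : Type*} [MeasurableSpace X] {T : X → X} (hT : Measurable T)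
    {f : X → ℂ} (hf : Measurable f) (N : ℕ) : Measurable (wwSup T N f) := by
  -- Continuity in `t` reduces the uncountable supremum to a countable dense set.
  obtain ⟨s, hs, hsd⟩ := TopologicalSpace.exists_countable_dense ℝ
  have : wwSup T N f = fun x => ⨆ t : s, ‖(1 / (N : ℂ)) * ∑ n ∈ Finset.Icc 1 N,
      Complex.exp (2 * Real.pi * Complex.I * n * (t : ℝ)) * f (T^[n] x)‖ := by
    funext x
    exact (hsd.ciSup' (f := fun t : ℝ => ‖(1 / (N : ℂ)) * ∑ n ∈ Finset.Icc 1 N,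
      Complex.exp (2 * Real.pi * Complex.I * n * t) * f (T^[n] x)‖) (by fun_prop)).symm
  rw [this]
  have := hs.to_subtype
  exact Measurable.iSup fun t => ((Finset.measurable_sum _ fun n _ =>
    (hf.comp (hT.iterate n)).const_mul _).const_mul _).norm

theorem wwAvg_one_eq {X : Type*} [MeasurableSpace X] (μ : Measure X) [IsProbabilityMeasure μ]
    {T : X → X} (hT : Measurable T) {f : X → ℂ} (hf : Measurable f) (N : ℕ) :
    wwAvg μ T N 1 f = (∫ x, wwSup T N f x ^ 2 ∂μ) ^ (1 / 3 : ℝ) := by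
  have h0 : 0 ≤ ∫ x, wwSup T N f x ^ 2 ∂μ := integral_nonneg fun x => by positivity
  simp only [wwAvg]
  rw [toReal_eLpNorm (measurable_wwSup hT hf N).aestronglyMeasurable,
    lpNorm_eq_integral_norm_rpow_toReal two_ne_zero ENNReal.ofNat_ne_top
      (measurable_wwSup hT hf N).aestronglyMeasurable]
  simp only [ENNReal.toReal_ofNat, Real.norm_eq_abs, Real.rpow_ofNat, sq_abs]
  rw [← Real.rpow_mul h0]
  norm_num

theorem integral_sq_wwSup_mem {X : Type*} [MeasurableSpace X] (μ : Measure X)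
    [IsProbabilityMeasure μ] {T : X → X} (hT : Measurable T) {f : X → ℂ} (hf : Measurable f)
    (hf1 : ∀ x, ‖f x‖ ≤ 1) (N : ℕ) : ∫ x, wwSup T N f x ^ 2 ∂μ ∈ Set.Icc (0 : ℝ) 1 := by
  refine ⟨integral_nonneg fun x => by positivity, ?_⟩
  have h1 : ∀ x, wwSup T N f x ^ 2 ≤ 1 := fun x =>
    pow_le_one₀ (wwSup_nonneg _ _ _ _) (wwSup_le_one hf1 N x)
  calc ∫ x, wwSup T N f x ^ 2 ∂μ ≤ ∫ _, (1 : ℝ) ∂μ := by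
        refine integral_mono (integrable_of_norm_le (C := 1)
          ((measurable_wwSup hT hf N).pow_const 2).aestronglyMeasurable fun x => ?_)
          (integrable_const _) h1
        rw [Real.norm_of_nonneg (by positivity)]
        exact h1 x
    _ = 1 := by simp

/-! ### Tensor products and bounded representatives -/

theorem measurable_tensorFun {X Y : Type*} [MeasurableSpace X] [MeasurableSpace Y] {f : X → ℂ}
    {g : Y → ℂ} (hf : Measurable f) (hg : Measurable g) : Measurable (tensorFun f g) :=
  (hf.comp measurable_fst).mul (hg.comp measurable_snd)

theorem norm_tensorFun_le_one {X Y : Type*} {f : X → ℂ} {g : Y → ℂ} (hf : ∀ x, ‖f x‖ ≤ 1)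
    (hg : ∀ y, ‖g y‖ ≤ 1) (p : X × Y) : ‖tensorFun f g p‖ ≤ 1 := by
  rw [tensorFun, norm_mul]
  exact mul_le_one₀ (hf _) (norm_nonneg _) (hg _)

theorem mulDeriv_tensorFun {X Y : Type*} (T : X → X) (S : Y → Y) (h : ℕ) (f : X → ℂ)
    (g : Y → ℂ) : mulDeriv (Prod.map T S) h (tensorFun f g) =
      tensorFun (mulDeriv T h f) (mulDeriv S h g) := by
  funext p
  simp only [mulDeriv, tensorFun, Prod.map_iterate, Prod.map_fst, Prod.map_snd, map_mul]
  ring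

theorem tensorFun_iterate {X Y : Type*} (T : X → X) (S : Y → Y) (n : ℕ) (f : X → ℂ)
    (g : Y → ℂ) (p : X × Y) : tensorFun f g ((Prod.map T S)^[n] p) =
      f (T^[n] p.1) * g (S^[n] p.2) := by
  simp only [tensorFun, Prod.map_iterate, Prod.map_fst, Prod.map_snd]

theorem sq_integral_le_integral_sq {X : Type*} [MeasurableSpace X] {μ : Measure X}
    [IsProbabilityMeasure μ] {A : X → ℝ} (hA : Measurable A) {C : ℝ} (hC : ∀ x, ‖A x‖ ≤ C) :
    (∫ x, A x ∂μ) ^ 2 ≤ ∫ x, A x ^ 2 ∂μ := by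
  set m := ∫ x, A x ∂μ with hm
  have hi : Integrable A μ := integrable_of_norm_le hA.aestronglyMeasurable hC
  have hi2 : Integrable (fun x => A x ^ 2) μ :=
    integrable_of_norm_le (C := C ^ 2) (hA.pow_const 2).aestronglyMeasurable fun x => by
      rw [norm_pow]
      exact pow_le_pow_left₀ (norm_nonneg _) (hC x) 2
  have h1 : ∫ x, (2 * m * A x - m ^ 2) ∂μ ≤ ∫ x, A x ^ 2 ∂μ :=
    integral_mono ((hi.const_mul _).sub (integrable_const _)) hi2 fun x => by
      simp only
      nlinarith [sq_nonneg (A x - m)]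
  rw [integral_sub (hi.const_mul _) (integrable_const _), integral_const_mul, ← hm] at h1
  simp only [integral_const, probReal_univ, one_smul] at h1
  linarith

theorem norm_tensor_average_le_one {X Y : Type*} {T : X → X} {S : Y → Y} {F : X → ℂ} {G : Y → ℂ}
    (hF1 : ∀ x, ‖F x‖ ≤ 1) (hG1 : ∀ y, ‖G y‖ ≤ 1) (N : ℕ) (p : X × Y) :
    ‖(1 / (N : ℂ)) * ∑ n ∈ Finset.Icc 1 N, F (T^[n] p.1) * G (S^[n] p.2)‖ ≤ 1 :=
  norm_average_le zero_le_one fun n => by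
    rw [norm_mul]
    exact mul_le_one₀ (hF1 _) (norm_nonneg _) (hG1 _)

/-- Truncating a measurable version to zero where it exceeds the bound makes all later estimates
pointwise. -/
theorem exists_measurable_bounded_ae_eq {X : Type*} [MeasurableSpace X] {μ : Measure X}
    {f : X → ℂ} (hf : AEStronglyMeasurable f μ) {M : ℝ}
    (hM : 0 ≤ M) (hb : ∀ᵐ x ∂μ, ‖f x‖ ≤ M) :
    ∃ f' : X → ℂ, Measurable f' ∧ (∀ x, ‖f' x‖ ≤ M) ∧ f =ᵐ[μ] f' := by
  obtain ⟨u, hu, hfu⟩ := hf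
  refine ⟨{x | ‖u x‖ ≤ M}.indicator u, hu.measurable.indicator
    (measurableSet_le hu.measurable.norm measurable_const), fun x => ?_, ?_⟩
  · by_cases hx : ‖u x‖ ≤ M
    · rwa [Set.indicator_of_mem (by exact hx)]
    · rwa [Set.indicator_of_notMem (by exact hx), norm_zero]
  · filter_upwards [hfu, hb] with x h1 h2
    rw [Set.indicator_of_mem (by rw [Set.mem_ofPred_eq, ← h1]; exact h2), h1]

theorem tensorFun_ae_eq {X Y : Type*} [MeasurableSpace X] [MeasurableSpace Y] {μ : Measure X}
    {ν : Measure Y} [SFinite ν] {f f' : X → ℂ} {g g' : Y → ℂ}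
    (hf : f =ᵐ[μ] f') (hg : g =ᵐ[ν] g') :
    tensorFun f g =ᵐ[μ.prod ν] tensorFun f' g' := by
  filter_upwards [Measure.quasiMeasurePreserving_fst.ae_eq_comp hf,
    Measure.quasiMeasurePreserving_snd.ae_eq_comp hg] with p h1 h2
  simp only [Function.comp_apply] at h1 h2
  simp only [tensorFun, h1, h2]

/-! ### The product bound -/

section Product

variable {X Y : Type*} [MeasurableSpace X] [MeasurableSpace Y] {μ : Measure X} {ν : Measure Y}
  [IsProbabilityMeasure μ] [IsProbabilityMeasure ν] {T : X → X} {S : Y → Y}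

theorem measurable_tensor_average (hT : Measurable T) (hS : Measurable S) {F : X → ℂ} {G : Y → ℂ}
    (hF : Measurable F) (hG : Measurable G) (N : ℕ) :
    Measurable fun p : X × Y =>
      ‖(1 / (N : ℂ)) * ∑ n ∈ Finset.Icc 1 N, F (T^[n] p.1) * G (S^[n] p.2)‖ :=
  ((Finset.measurable_sum _ fun n _ => (hF.comp ((hT.iterate n).comp measurable_fst)).mul
    (hG.comp ((hS.iterate n).comp measurable_snd))).const_mul _).norm

/-- Fubini, then von Neumann's inequality in `Y` for fixed `x`, with coefficients `F(Tⁿx)/N`. Only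
`|G| ≤ 1` enters, so the bound is uniform in `G`. -/
theorem integral_sq_tensor_average_le (hT : Measurable T) (hS : MeasurePreserving S ν ν)
    {F : X → ℂ} {G : Y → ℂ} (hF : Measurable F) (hG : Measurable G) (hF1 : ∀ x, ‖F x‖ ≤ 1)
    (hG1 : ∀ y, ‖G y‖ ≤ 1) (N : ℕ) :
    ∫ p, ‖(1 / (N : ℂ)) * ∑ n ∈ Finset.Icc 1 N, F (T^[n] p.1) * G (S^[n] p.2)‖ ^ 2 ∂(μ.prod ν) ≤
      ∫ x, wwSup T N F x ^ 2 ∂μ := by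
  have hi : Integrable (fun p : X × Y => ‖(1 / (N : ℂ)) * ∑ n ∈ Finset.Icc 1 N,
      F (T^[n] p.1) * G (S^[n] p.2)‖ ^ 2) (μ.prod ν) :=
    integrable_of_norm_le (C := 1)
      ((measurable_tensor_average hT hS.measurable hF hG N).pow_const 2).aestronglyMeasurable
      fun p => by
        rw [Real.norm_of_nonneg (by positivity)]
        exact pow_le_one₀ (norm_nonneg _) (norm_tensor_average_le_one hF1 hG1 N p)
  rw [integral_prod _ hi]
  refine integral_mono hi.integral_prod_left (integrable_of_norm_le (C := 1)
    ((measurable_wwSup hT hF N).pow_const 2).aestronglyMeasurable fun x => ?_) fun x => ?_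
  · rw [Real.norm_of_nonneg (by positivity)]
    exact pow_le_one₀ (wwSup_nonneg _ _ _ _) (wwSup_le_one hF1 N x)
  · have := integral_norm_sq_orbit_sum_le hS hG hG1
      (c := fun n => (1 / (N : ℂ)) * F (T^[n] x)) (N := N) (M := wwSup T N F x) fun t => by
        have := norm_trigAverage_le_trigSup N (fun n => F (T^[n] x)) t
        rw [Finset.mul_sum] at this
        refine le_trans (le_of_eq ?_) this
        congr 1
        exact Finset.sum_congr rfl fun n _ => by ring
    simp only [mul_assoc, ← Finset.mul_sum] at this
    exact this

/-- Cauchy-Schwarz gives the square root of `∫ sup²`; this integral lies in `[0, 1]`, so the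
exponent `1/2` may be lowered to the `1/3` of the order 1 average. -/
theorem integral_tensor_average_le_wwAvg_one (hT : Measurable T) (hS : MeasurePreserving S ν ν)
    {F : X → ℂ} {G : Y → ℂ} (hF : Measurable F) (hG : Measurable G) (hF1 : ∀ x, ‖F x‖ ≤ 1)
    (hG1 : ∀ y, ‖G y‖ ≤ 1) (N : ℕ) :
    ∫ p, ‖(1 / (N : ℂ)) * ∑ n ∈ Finset.Icc 1 N, F (T^[n] p.1) * G (S^[n] p.2)‖ ∂(μ.prod ν) ≤
      wwAvg μ T N 1 F := by
  have h1 := (sq_integral_le_integral_sq (μ := μ.prod ν) (C := 1)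
    (measurable_tensor_average hT hS.measurable hF hG N)
    (fun p => by rw [norm_norm]; exact norm_tensor_average_le_one hF1 hG1 N p)).trans
    (integral_sq_tensor_average_le hT hS hF hG hF1 hG1 N)
  obtain ⟨h0, h1'⟩ := integral_sq_wwSup_mem μ hT hF hF1 N
  rw [wwAvg_one_eq μ hT hF]
  refine (Real.le_sqrt_of_sq_le h1).trans ?_
  rw [Real.sqrt_eq_rpow]
  rcases h0.eq_or_lt with h | h
  · rw [← h]; simp
  · exact Real.rpow_le_rpow_of_exponent_ge h h1' (by norm_num)

/-- After van der Corput's inequality, averaging the order 1 bounds over the derivatives of `f` is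
exactly the recursion defining order 2. -/
theorem integral_sq_wwSup_tensorFun_le (hT : Measurable T) (hS : MeasurePreserving S ν ν)
    {f : X → ℂ} {g : Y → ℂ} (hf : Measurable f) (hg : Measurable g) (hf1 : ∀ x, ‖f x‖ ≤ 1)
    (hg1 : ∀ y, ‖g y‖ ≤ 1) {N : ℕ} (hN : 1 ≤ N) :
    ∫ p, wwSup (Prod.map T S) N (tensorFun f g) p ^ 2 ∂(μ.prod ν) ≤
      16 / Real.sqrt N + 4 * wwAvg μ T N 2 f := by
  set A : ℕ → X × Y → ℝ := fun d p => ‖(1 / (N : ℂ)) * ∑ n ∈ Finset.Icc 1 N,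
    mulDeriv T d f (T^[n] p.1) * mulDeriv S d g (S^[n] p.2)‖ with hA
  have hTd := fun d => measurable_mulDeriv hT hf d
  have hSd := fun d => measurable_mulDeriv hS.measurable hg d
  have hAi : ∀ d, Integrable (A d) (μ.prod ν) := fun d =>
    integrable_of_norm_le (C := 1)
      (measurable_tensor_average hT hS.measurable (hTd d) (hSd d) N).aestronglyMeasurable
      fun p => by
        rw [norm_norm]
        exact norm_tensor_average_le_one (norm_mulDeriv_le_one hf1 d)
          (norm_mulDeriv_le_one hg1 d) N p
  have hpt : ∀ p, wwSup (Prod.map T S) N (tensorFun f g) p ^ 2 ≤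
      16 / Real.sqrt N + 4 / (Nat.sqrt N : ℝ) * ∑ d ∈ Finset.Icc 1 (Nat.sqrt N), A d p := by
    intro p
    refine (trigSup_sq_le (fun n => norm_tensorFun_le_one hf1 hg1 _) hN).trans (le_of_eq ?_)
    congr 2
    refine Finset.sum_congr rfl fun d _ => ?_
    simp only [hA]
    congr 2
    refine Finset.sum_congr rfl fun n _ => ?_
    rw [tensorFun_iterate, tensorFun_iterate, mulDeriv, mulDeriv, ← Function.iterate_add_apply,
      ← Function.iterate_add_apply, add_comm d n, map_mul]
    ring
  have hsi : Integrable (fun p => ∑ d ∈ Finset.Icc 1 (Nat.sqrt N), A d p) (μ.prod ν) :=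
    integrable_finsetSum _ fun d _ => hAi d
  calc _ ≤ ∫ p, (16 / Real.sqrt N + 4 / (Nat.sqrt N : ℝ) *
        ∑ d ∈ Finset.Icc 1 (Nat.sqrt N), A d p) ∂(μ.prod ν) := by
        refine integral_mono (integrable_of_norm_le (C := 1) ((measurable_wwSup
          (hT.prodMap hS.measurable) (measurable_tensorFun hf hg) N).pow_const
          2).aestronglyMeasurable fun p => ?_) ((integrable_const _).add (hsi.const_mul _)) hpt
        rw [Real.norm_of_nonneg (by positivity)]
        exact pow_le_one₀ (wwSup_nonneg _ _ _ _) (wwSup_le_one (norm_tensorFun_le_one hf1 hg1) N p)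
    _ = 16 / Real.sqrt N + 4 / (Nat.sqrt N : ℝ) *
        ∑ d ∈ Finset.Icc 1 (Nat.sqrt N), ∫ p, A d p ∂(μ.prod ν) := by
        rw [integral_add (integrable_const _) (hsi.const_mul _), integral_const_mul,
          integral_finsetSum _ fun d _ => hAi d]
        simp
    _ ≤ 16 / Real.sqrt N + 4 / (Nat.sqrt N : ℝ) *
        ∑ d ∈ Finset.Icc 1 (Nat.sqrt N), wwAvg μ T N 1 (mulDeriv T d f) := by
        gcongr with d hd
        exact integral_tensor_average_le_wwAvg_one hT hS (hTd d) (hSd d)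
          (norm_mulDeriv_le_one hf1 d) (norm_mulDeriv_le_one hg1 d) N
    _ = _ := by
        rw [wwAvg_add_two]
        ring

theorem wwAvg_one_tensorFun_le (hT : Measurable T) (hS : MeasurePreserving S ν ν)
    {f : X → ℂ} {g : Y → ℂ} (hf : Measurable f) (hg : Measurable g) (hf1 : ∀ x, ‖f x‖ ≤ 1)
    (hg1 : ∀ y, ‖g y‖ ≤ 1) {N : ℕ} (hN : 1 ≤ N) :
    wwAvg (μ.prod ν) (Prod.map T S) N 1 (tensorFun f g) ≤
      16 * (1 / (N : ℝ) ^ (1 / 6 : ℝ) + wwAvg μ T N 2 f ^ (1 / 8 : ℝ)) := by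
  have hN' : (0 : ℝ) < N := by exact_mod_cast hN
  have hW0 := wwAvg_nonneg μ T N 2 f
  have hW1 := wwAvg_le_one μ T N 2 hf1
  rw [wwAvg_one_eq _ (hT.prodMap hS.measurable) (measurable_tensorFun hf hg)]
  have h1 : (1 / Real.sqrt N) ^ (1 / 3 : ℝ) = 1 / (N : ℝ) ^ (1 / 6 : ℝ) := by
    rw [Real.sqrt_eq_rpow, Real.div_rpow zero_le_one (by positivity), Real.one_rpow,
      ← Real.rpow_mul hN'.le]
    norm_num
  have h2 : ∀ a : ℝ, 1 ≤ a → a ^ (1 / 3 : ℝ) ≤ a := fun a ha => by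
    conv_rhs => rw [← Real.rpow_one a]
    exact Real.rpow_le_rpow_of_exponent_le ha (by norm_num)
  -- The cube root yields exponent `1/3`; it is weakened to `1/8` because the average is at most 1.
  have h3 : wwAvg μ T N 2 f ^ (1 / 3 : ℝ) ≤ wwAvg μ T N 2 f ^ (1 / 8 : ℝ) := by
    rcases hW0.eq_or_lt with h | h
    · rw [← h]; simp
    · exact Real.rpow_le_rpow_of_exponent_ge h hW1 (by norm_num)
  calc _ ≤ (16 * (1 / Real.sqrt N) + 4 * wwAvg μ T N 2 f) ^ (1 / 3 : ℝ) := by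
        refine Real.rpow_le_rpow (integral_nonneg fun x => by positivity) ?_ (by norm_num)
        rw [mul_one_div]
        exact integral_sq_wwSup_tensorFun_le hT hS hf hg hf1 hg1 hN
    _ ≤ (16 * (1 / Real.sqrt N)) ^ (1 / 3 : ℝ) + (4 * wwAvg μ T N 2 f) ^ (1 / 3 : ℝ) :=
        Real.rpow_add_le_add_rpow (by positivity) (by positivity) (by norm_num) (by norm_num)
    _ = 16 ^ (1 / 3 : ℝ) * (1 / (N : ℝ) ^ (1 / 6 : ℝ)) +
        4 ^ (1 / 3 : ℝ) * wwAvg μ T N 2 f ^ (1 / 3 : ℝ) := by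
        rw [Real.mul_rpow (by norm_num) (by positivity), Real.mul_rpow (by norm_num) hW0, h1]
    _ ≤ 16 * (1 / (N : ℝ) ^ (1 / 6 : ℝ)) + 16 * wwAvg μ T N 2 f ^ (1 / 8 : ℝ) := by
        gcongr
        · exact h2 16 (by norm_num)
        · exact (h2 4 (by norm_num)).trans (by norm_num)
    _ = _ := by ring

/-- Concavity of `x^{1/8}`, in the form of the power mean inequality with exponent 8. -/
theorem average_rpow_le {H : ℕ} (hH : 1 ≤ H) {a : ℕ → ℝ} (ha : ∀ h, 0 ≤ a h) :
    1 / (H : ℝ) * ∑ h ∈ Finset.Icc 1 H, a h ^ (1 / 8 : ℝ) ≤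
      (1 / (H : ℝ) * ∑ h ∈ Finset.Icc 1 H, a h) ^ (1 / 8 : ℝ) := by
  have hH' : (0 : ℝ) < H := by exact_mod_cast hH
  have := Real.arith_mean_le_rpow_mean (Finset.Icc 1 H) (fun _ => 1 / (H : ℝ))
    (fun h => a h ^ (1 / 8 : ℝ)) (fun _ _ => by positivity) (by simp [hH'.ne'])
    (fun h _ => Real.rpow_nonneg (ha h) _) (p := 8) (by norm_num)
  simp_rw [← Finset.mul_sum, ← Real.rpow_mul (ha _)] at this
  norm_num at this ⊢
  exact this

/-- Induction on the order at fixed `N`. The error term does not depend on `d`, so averaging leaves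
the constant 16 unchanged. -/
theorem wwAvg_tensorFun_le (hT : Measurable T) (hS : MeasurePreserving S ν ν)
    {N : ℕ} (hN : 1 ≤ N) (k : ℕ) : ∀ {f : X → ℂ} {g : Y → ℂ}, Measurable f → Measurable g →
    (∀ x, ‖f x‖ ≤ 1) → (∀ y, ‖g y‖ ≤ 1) →
    wwAvg (μ.prod ν) (Prod.map T S) N (k + 1) (tensorFun f g) ≤
      16 * (1 / (N : ℝ) ^ (1 / 6 : ℝ) + wwAvg μ T N (k + 2) f ^ (1 / 8 : ℝ)) := by
  induction k with
  | zero => exact fun hf hg hf1 hg1 => wwAvg_one_tensorFun_le hT hS hf hg hf1 hg1 hN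
  | succ k ih =>
    intro f g hf hg hf1 hg1
    have hH : 1 ≤ Nat.sqrt N := Nat.sqrt_pos.2 hN
    have hH' : (Nat.sqrt N : ℝ) ≠ 0 := by positivity
    have hstep : ∀ d, wwAvg (μ.prod ν) (Prod.map T S) N (k + 1)
        (mulDeriv (Prod.map T S) d (tensorFun f g)) ≤
        16 * (1 / (N : ℝ) ^ (1 / 6 : ℝ) +
          wwAvg μ T N (k + 2) (mulDeriv T d f) ^ (1 / 8 : ℝ)) := by
      intro d
      rw [mulDeriv_tensorFun]
      exact ih (measurable_mulDeriv hT hf d) (measurable_mulDeriv hS.measurable hg d)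
        (norm_mulDeriv_le_one hf1 d) (norm_mulDeriv_le_one hg1 d)
    rw [wwAvg_add_two _ _ _ k, wwAvg_add_two _ _ _ (k + 1)]
    calc _ ≤ 1 / (Nat.sqrt N : ℝ) * ∑ d ∈ Finset.Icc 1 (Nat.sqrt N),
          16 * (1 / (N : ℝ) ^ (1 / 6 : ℝ) +
            wwAvg μ T N (k + 2) (mulDeriv T d f) ^ (1 / 8 : ℝ)) := by
          gcongr with d hd
          exact hstep d
      _ = 16 * (1 / (N : ℝ) ^ (1 / 6 : ℝ) + 1 / (Nat.sqrt N : ℝ) *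
          ∑ d ∈ Finset.Icc 1 (Nat.sqrt N),
            wwAvg μ T N (k + 2) (mulDeriv T d f) ^ (1 / 8 : ℝ)) := by
          rw [← Finset.mul_sum, Finset.sum_add_distrib]
          simp only [Finset.sum_const, Nat.card_Icc, Nat.add_sub_cancel, nsmul_eq_mul]
          field_simp
      _ ≤ _ := by
          gcongr
          exact average_rpow_le hH fun d => wwAvg_nonneg _ _ _ _ _

theorem wwAvg_tensorFun_swap (N k : ℕ) (f : X → ℂ) (g : Y → ℂ) :
    wwAvg (μ.prod ν) (Prod.map T S) N k (tensorFun f g) =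
      wwAvg (ν.prod μ) (Prod.map S T) N k (tensorFun g f) := by
  rw [← wwAvg_comp_measurableEquiv (μ := μ.prod ν) (T := Prod.map T S) MeasurableEquiv.prodComm
    Measure.measurePreserving_swap (fun p => rfl) N k]
  congr 1
  funext p
  exact mul_comm _ _

theorem wwAvg_tensorFun_le_min (hT : MeasurePreserving T μ μ) (hS : MeasurePreserving S ν ν)
    {f : X → ℂ} {g : Y → ℂ} (hf : AEStronglyMeasurable f μ) (hg : AEStronglyMeasurable g ν)
    (hf1 : ∀ᵐ x ∂μ, ‖f x‖ ≤ 1) (hg1 : ∀ᵐ y ∂ν, ‖g y‖ ≤ 1) {k : ℕ} (hk : 1 ≤ k) {N : ℕ}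
    (hN : 1 ≤ N) :
    wwAvg (μ.prod ν) (Prod.map T S) N k (tensorFun f g) ≤
      16 * (1 / (N : ℝ) ^ (1 / 6 : ℝ) +
        (min (wwAvg μ T N (k + 1) f) (wwAvg ν S N (k + 1) g)) ^ (1 / 8 : ℝ)) := by
  obtain ⟨k, rfl⟩ := Nat.exists_eq_add_of_le' hk
  obtain ⟨f', hfm, hfb, hff⟩ := exists_measurable_bounded_ae_eq hf zero_le_one hf1
  obtain ⟨g', hgm, hgb, hgg⟩ := exists_measurable_bounded_ae_eq hg zero_le_one hg1
  rw [wwAvg_congr_ae (hT.prod hS) N _ (tensorFun_ae_eq hff hgg), wwAvg_congr_ae hT N _ hff,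
    wwAvg_congr_ae hS N _ hgg]
  rcases min_choice (wwAvg μ T N (k + 1 + 1) f') (wwAvg ν S N (k + 1 + 1) g') with h | h <;> rw [h]
  · exact wwAvg_tensorFun_le hT.measurable hS hN k hfm hgm hfb hgb
  · rw [wwAvg_tensorFun_swap]
    exact wwAvg_tensorFun_le hS.measurable hT hN k hgm hfm hgb hfb

end Product

/-! ### Lower bounds and rigidity for fast decay -/

theorem integral_sq_norm_mem {X : Type*} [MeasurableSpace X] (μ : Measure X)
    [IsProbabilityMeasure μ] {f : X → ℂ} (hf : Measurable f) (hf1 : ∀ x, ‖f x‖ ≤ 1) :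
    ∫ x, ‖f x‖ ^ 2 ∂μ ∈ Set.Icc (0 : ℝ) 1 := by
  refine ⟨integral_nonneg fun x => by positivity, ?_⟩
  have h1 : ∀ x, ‖f x‖ ^ 2 ≤ 1 := fun x => pow_le_one₀ (norm_nonneg _) (hf1 x)
  calc ∫ x, ‖f x‖ ^ 2 ∂μ ≤ ∫ _, (1 : ℝ) ∂μ := by
        refine integral_mono (integrable_of_norm_le (C := 1)
          (hf.norm.pow_const 2).aestronglyMeasurable fun x => ?_) (integrable_const _) h1
        rw [Real.norm_of_nonneg (by positivity)]
        exact h1 x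
    _ = 1 := by simp

theorem exists_normalization {X : Type*} [MeasurableSpace X] {μ : Measure X} {f : X → ℂ}
    (hf : MemLp f ∞ μ) : ∃ (M : ℝ) (u : X → ℂ), 0 < M ∧ Measurable u ∧ (∀ x, ‖u x‖ ≤ 1) ∧ f =ᵐ[μ] fun x => (M : ℂ) * u x := by
  -- The maximum with 1 keeps the divisor positive even when `f` vanishes.
  set M := max 1 (lpNorm f ∞ μ) with hM
  have hM0 : 0 < M := lt_of_lt_of_le one_pos (le_max_left _ _)
  obtain ⟨f', hfm, hfb, hff⟩ := exists_measurable_bounded_ae_eq hf.1 hM0.le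
    ((ae_le_lpNorm_exponent_top hf).mono fun x hx => hx.trans (le_max_right _ _))
  have hMC : (M : ℂ) ≠ 0 := by exact_mod_cast hM0.ne'
  refine ⟨M, fun x => (M : ℂ)⁻¹ * f' x, hM0, hfm.const_mul _, fun x => ?_, ?_⟩
  · rw [norm_mul, norm_inv, Complex.norm_real, Real.norm_of_nonneg hM0.le, inv_mul_le_iff₀ hM0,
      mul_one]
    exact hfb x
  · filter_upwards [hff] with x hx
    rw [hx, mul_inv_cancel_left₀ hMC]

section System

variable {X : Type*} [MeasurableSpace X] {μ : Measure X} [IsProbabilityMeasure μ] {T : X → X}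

/-- A quantitative form of Khintchine's recurrence theorem. -/
theorem average_correlation_ge (hT : MeasurePreserving T μ μ) {F : X → ℝ} (hF : Measurable F)
    (hF0 : ∀ x, 0 ≤ F x) (hF1 : ∀ x, F x ≤ 1) {H : ℕ} (hH : 1 ≤ H) :
    ((∫ x, F x ∂μ) ^ 2 - 1 / H) / 2 ≤
      1 / (H : ℝ) * ∑ h ∈ Finset.Icc 1 H, ∫ x, F x * F (T^[h] x) ∂μ := by
  have hH' : (0 : ℝ) < H := by exact_mod_cast hH
  set m : ℕ → ℝ := fun d => ∫ x, F x * F (T^[d] x) ∂μ with hm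
  have hm0 : ∀ d, 0 ≤ m d := fun d => integral_nonneg fun x => mul_nonneg (hF0 _) (hF0 _)
  have hFn : ∀ n, Measurable fun x => F (T^[n] x) := fun n => hF.comp (hT.measurable.iterate n)
  have hFi : ∀ n, Integrable (fun x => F (T^[n] x)) μ := fun n =>
    integrable_of_norm_le (C := 1) (hFn n).aestronglyMeasurable fun x => by
      rw [Real.norm_of_nonneg (hF0 _)]; exact hF1 _
  have hFF : ∀ i j, Integrable (fun x => F (T^[i] x) * F (T^[j] x)) μ := fun i j =>
    integrable_of_norm_le (C := 1) ((hFn i).mul (hFn j)).aestronglyMeasurable fun x => by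
      rw [Real.norm_of_nonneg (mul_nonneg (hF0 _) (hF0 _))]
      exact mul_le_one₀ (hF1 _) (hF0 _) (hF1 _)
  have hshift : ∀ i d, ∫ x, F (T^[i] x) * F (T^[i + d] x) ∂μ = m d := by
    intro i d
    have h := integral_comp_measurePreserving (hT.iterate i) (f := fun x => F x * F (T^[d] x))
      (hF.mul (hFn d))
    simp only [← Function.iterate_add_apply] at h
    rw [add_comm i d]
    exact h
  have hdiag : ∀ i, ∫ x, F (T^[i] x) * F (T^[i] x) ∂μ ≤ 1 := by
    intro i
    calc _ ≤ ∫ _, (1 : ℝ) ∂μ := integral_mono (hFF i i) (integrable_const _) fun x =>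
          mul_le_one₀ (hF1 _) (hF0 _) (hF1 _)
      _ = 1 := by simp
  have hr : ∀ i ∈ Finset.range H, ∀ j ∈ Finset.range H,
      ∫ x, F (T^[i] x) * F (T^[j] x) ∂μ ≤ (if j = i then 1 else 0) +
        ∑ d ∈ Finset.Icc 1 H, ((if j = i + d then 1 else 0) + (if i = j + d then 1 else 0)) *
          m d := by
    intro i hi j hj
    rw [Finset.mem_range] at hi hj
    have hpos : ∀ d ∈ Finset.Icc 1 H, (0 : ℝ) ≤
        ((if j = i + d then 1 else 0) + (if i = j + d then 1 else 0)) * m d := fun d _ =>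
      mul_nonneg (by positivity) (hm0 d)
    rcases lt_trichotomy i j with h | h | h
    · have h1 := Finset.single_le_sum hpos (a := j - i) (by rw [Finset.mem_Icc]; omega)
      rw [if_pos (by omega), if_neg (by omega)] at h1
      have h2 := hshift i (j - i)
      rw [show i + (j - i) = j by omega] at h2
      rw [h2, if_neg h.ne']
      linarith
    · subst h
      rw [if_pos rfl]
      linarith [hdiag i, Finset.sum_nonneg hpos]
    · have h1 := Finset.single_le_sum hpos (a := i - j) (by rw [Finset.mem_Icc]; omega)
      rw [if_neg (by omega), if_pos (by omega)] at h1
      have h2 := hshift j (i - j)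
      rw [show j + (i - j) = i by omega] at h2
      simp_rw [mul_comm (F (T^[i] _))]
      rw [h2, if_neg h.ne]
      linarith
  -- In a row the diagonal contributes at most 1, and each lag at most twice. Summed over rows, this
  -- bounds the second moment of the orbit sum, which is at least `H² (∫ F)²`.
  have hrow : ∀ i ∈ Finset.range H, ∑ j ∈ Finset.range H, ∫ x, F (T^[i] x) * F (T^[j] x) ∂μ ≤
      1 + 2 * ∑ d ∈ Finset.Icc 1 H, m d := by
    intro i hi
    refine (Finset.sum_le_sum (hr i hi)).trans ?_
    rw [Finset.sum_add_distrib, Finset.sum_comm, Finset.mul_sum]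
    simp_rw [← Finset.sum_mul, Finset.sum_add_distrib]
    refine add_le_add ?_ (Finset.sum_le_sum fun d _ => mul_le_mul_of_nonneg_right ?_ (hm0 d))
    · rw [Finset.sum_ite_eq']
      split_ifs <;> norm_num
    · have h1 : ∑ j ∈ Finset.range H, (if j = i + d then (1 : ℝ) else 0) ≤ 1 := by
        rw [Finset.sum_ite_eq']
        split_ifs <;> norm_num
      have h2 : ∑ j ∈ Finset.range H, (if i = j + d then (1 : ℝ) else 0) ≤ 1 := by
        -- Truncated subtraction is harmless: for `d > i` the left indicator vanishes identically.
        calc _ ≤ ∑ j ∈ Finset.range H, (if j = i - d then (1 : ℝ) else 0) := by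
              refine Finset.sum_le_sum fun j _ => ?_
              split_ifs with h3 h4
              · exact le_rfl
              · omega
              · exact zero_le_one
              · exact le_rfl
          _ ≤ 1 := by
              rw [Finset.sum_ite_eq']
              split_ifs <;> norm_num
      linarith
  have hS : (∫ x, ∑ i ∈ Finset.range H, F (T^[i] x) ∂μ) ^ 2 ≤
      ∫ x, (∑ i ∈ Finset.range H, F (T^[i] x)) ^ 2 ∂μ :=
    sq_integral_le_integral_sq (C := H) (Finset.measurable_sum _ fun i _ => hFn i) fun x => by
      refine (norm_sum_le_of_le _ (n := fun _ => (1 : ℝ)) fun i _ => ?_).trans (by simp)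
      rw [Real.norm_of_nonneg (hF0 _)]
      exact hF1 _
  have hl : ∫ x, ∑ i ∈ Finset.range H, F (T^[i] x) ∂μ = H * ∫ x, F x ∂μ := by
    rw [integral_finsetSum _ fun i _ => hFi i]
    simp_rw [integral_comp_measurePreserving (hT.iterate _) hF]
    simp
  have hr2 : ∫ x, (∑ i ∈ Finset.range H, F (T^[i] x)) ^ 2 ∂μ ≤
      H * (1 + 2 * ∑ d ∈ Finset.Icc 1 H, m d) := by
    simp_rw [sq, Finset.sum_mul_sum]
    rw [integral_finsetSum _ fun i _ => integrable_finsetSum _ fun j _ => hFF i j]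
    simp_rw [integral_finsetSum _ fun j _ => hFF _ j]
    calc _ ≤ ∑ i ∈ Finset.range H, (1 + 2 * ∑ d ∈ Finset.Icc 1 H, m d) :=
          Finset.sum_le_sum hrow
      _ = _ := by rw [Finset.sum_const, Finset.card_range, nsmul_eq_mul]
  rw [hl] at hS
  have h3 : H * (H * (∫ x, F x ∂μ) ^ 2) ≤ H * (1 + 2 * ∑ d ∈ Finset.Icc 1 H, m d) := by
    linarith
  have h4 := le_of_mul_le_mul_left h3 hH'
  rw [one_div_mul_eq_div, le_div_iff₀ hH']
  have : (((∫ x, F x ∂μ) ^ 2 - 1 / H) / 2) * H = (H * (∫ x, F x ∂μ) ^ 2 - 1) / 2 := by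
    field_simp
  rw [this]
  linarith

/-- Integrating the Parseval lower bound gives `∫|f|² ≤ N ∫ sup²`; take cube roots, which only
increases a number in `[0, 1]`. -/
theorem integral_sq_norm_le_wwAvg_one (hT : MeasurePreserving T μ μ) {f : X → ℂ}
    (hf : Measurable f) (hf1 : ∀ x, ‖f x‖ ≤ 1) {N : ℕ} (hN : 1 ≤ N) :
    ∫ x, ‖f x‖ ^ 2 ∂μ ≤ (N : ℝ) ^ (1 / 3 : ℝ) * wwAvg μ T N 1 f := by
  have hN' : (0 : ℝ) < N := by exact_mod_cast hN
  obtain ⟨h0, h1⟩ := integral_sq_norm_mem μ hf hf1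
  have hi : ∀ n, Integrable (fun x => ‖f (T^[n] x)‖ ^ 2) μ := fun n =>
    integrable_of_norm_le (C := 1)
      ((hf.comp (hT.measurable.iterate n)).norm.pow_const 2).aestronglyMeasurable fun x => by
      rw [Real.norm_of_nonneg (by positivity)]
      exact pow_le_one₀ (norm_nonneg _) (hf1 _)
  have h2 : 1 / (N : ℝ) * ∫ x, ‖f x‖ ^ 2 ∂μ ≤ ∫ x, wwSup T N f x ^ 2 ∂μ := by
    calc 1 / (N : ℝ) * ∫ x, ‖f x‖ ^ 2 ∂μ
        = ∫ x, 1 / (N : ℝ) ^ 2 * ∑ n ∈ Finset.Icc 1 N, ‖f (T^[n] x)‖ ^ 2 ∂μ := by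
          rw [integral_const_mul, integral_finsetSum _ fun n _ => hi n]
          simp_rw [integral_comp_measurePreserving (hT.iterate _) (hf.norm.pow_const 2)]
          simp only [Finset.sum_const, Nat.card_Icc, Nat.add_sub_cancel, nsmul_eq_mul]
          field_simp
      _ ≤ _ := by
          refine integral_mono ((integrable_finsetSum _ fun n _ => hi n).const_mul _)
            (integrable_of_norm_le (C := 1)
              ((measurable_wwSup hT.measurable hf N).pow_const 2).aestronglyMeasurable
              fun x => ?_) fun x => sum_norm_sq_le_trigSup_sq hN _
          rw [Real.norm_of_nonneg (by positivity)]
          exact pow_le_one₀ (wwSup_nonneg _ _ _ _) (wwSup_le_one hf1 N x)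
  rw [wwAvg_one_eq μ hT.measurable hf]
  calc ∫ x, ‖f x‖ ^ 2 ∂μ ≤ (∫ x, ‖f x‖ ^ 2 ∂μ) ^ (1 / 3 : ℝ) := by
        rcases h0.eq_or_lt with h | h
        · rw [← h]; simp
        · conv_lhs => rw [← Real.rpow_one (∫ x, ‖f x‖ ^ 2 ∂μ)]
          exact Real.rpow_le_rpow_of_exponent_ge h h1 (by norm_num)
    _ ≤ (N * ∫ x, wwSup T N f x ^ 2 ∂μ) ^ (1 / 3 : ℝ) := by
        refine Real.rpow_le_rpow h0 ?_ (by norm_num)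
        rwa [one_div, inv_mul_le_iff₀ hN'] at h2
    _ = _ := Real.mul_rpow hN'.le (integral_nonneg fun x => by positivity)

/-- Wiener-Wintner averages of any order decay no faster than `N^{-1/3}`. -/
theorem exists_wwAvg_lower_bound (hT : MeasurePreserving T μ μ) (k : ℕ) : ∀ δ : ℝ, 0 < δ →
    ∃ c : ℝ, 0 < c ∧ ∃ N₀ : ℕ, ∀ N : ℕ, N₀ ≤ N → ∀ f : X → ℂ, Measurable f →
      (∀ x, ‖f x‖ ≤ 1) →
      c * (∫ x, ‖f x‖ ^ 2 ∂μ - δ) ≤ (N : ℝ) ^ (1 / 3 : ℝ) * wwAvg μ T N (k + 1) f := by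
  induction k with
  | zero =>
    refine fun δ hδ => ⟨1, one_pos, 1, fun N hN f hf hf1 => ?_⟩
    linarith [integral_sq_norm_le_wwAvg_one hT hf hf1 hN]
  | succ k ih =>
    intro δ hδ
    -- `c` and `N₁` serve every bounded `f`, so they apply to all derivatives at once. With `m =
    -- ∫|f|²` and `1/H ≤ δ²/2`, recurrence gives `A ≥ m²/2 - δ²/4`. Subtracting the new threshold
    -- `δ²/4` leaves `(m² - δ²)/2 ≥ δ(m - δ)`, whence the constant `c * δ`.
    obtain ⟨c, hc, N₁, hN₁⟩ := ih (δ ^ 2 / 4) (by positivity)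
    obtain ⟨H₀, hH₀⟩ := exists_nat_gt (2 / δ ^ 2)
    refine ⟨c * δ, by positivity, max N₁ (H₀ ^ 2), fun N hN f hf hf1 => ?_⟩
    have hH : H₀ ≤ Nat.sqrt N := Nat.le_sqrt'.2 ((le_max_right _ _).trans hN)
    have hH₀0 : (0 : ℝ) < H₀ := lt_trans (by positivity) hH₀
    have hHR : (H₀ : ℝ) ≤ Nat.sqrt N := by exact_mod_cast hH
    have hH' : (0 : ℝ) < Nat.sqrt N := by linarith
    have hH1 : 1 ≤ Nat.sqrt N := by exact_mod_cast hH'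
    have hinv : 1 / (Nat.sqrt N : ℝ) ≤ δ ^ 2 / 2 := by
      rw [div_lt_iff₀ (by positivity)] at hH₀
      rw [div_le_iff₀ hH']
      nlinarith [sq_nonneg δ]
    have hcor := average_correlation_ge hT (F := fun x => ‖f x‖ ^ 2) (hf.norm.pow_const 2)
      (fun x => by positivity) (fun x => pow_le_one₀ (norm_nonneg _) (hf1 x)) hH1
    have hnorm : ∀ d x, ‖mulDeriv T d f x‖ ^ 2 = ‖f x‖ ^ 2 * ‖f (T^[d] x)‖ ^ 2 := by
      intro d x
      rw [mulDeriv, norm_mul, RCLike.norm_conj, mul_pow]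
    set m := ∫ x, ‖f x‖ ^ 2 ∂μ with hm
    set A := 1 / (Nat.sqrt N : ℝ) * ∑ h ∈ Finset.Icc 1 (Nat.sqrt N),
      ∫ x, ‖f x‖ ^ 2 * ‖f (T^[h] x)‖ ^ 2 ∂μ with hA
    have hlow : c * (A - δ ^ 2 / 4) ≤ (N : ℝ) ^ (1 / 3 : ℝ) * wwAvg μ T N (k + 2) f := by
      calc c * (A - δ ^ 2 / 4) = 1 / (Nat.sqrt N : ℝ) * ∑ h ∈ Finset.Icc 1 (Nat.sqrt N),
            c * (∫ x, ‖mulDeriv T h f x‖ ^ 2 ∂μ - δ ^ 2 / 4) := by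
            simp_rw [hnorm]
            rw [← Finset.mul_sum, Finset.sum_sub_distrib, hA]
            simp only [Finset.sum_const, Nat.card_Icc, Nat.add_sub_cancel, nsmul_eq_mul]
            field_simp
        _ ≤ 1 / (Nat.sqrt N : ℝ) * ∑ h ∈ Finset.Icc 1 (Nat.sqrt N),
            (N : ℝ) ^ (1 / 3 : ℝ) * wwAvg μ T N (k + 1) (mulDeriv T h f) := by
            refine mul_le_mul_of_nonneg_left (Finset.sum_le_sum fun d _ => ?_) (by positivity)
            exact hN₁ N ((le_max_left _ _).trans hN) _ (measurable_mulDeriv hT.measurable hf d)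
              (norm_mulDeriv_le_one hf1 d)
        _ = _ := by
            rw [← Finset.mul_sum, wwAvg_add_two]
            ring
    refine le_trans ?_ hlow
    rw [mul_assoc]
    refine mul_le_mul_of_nonneg_left ?_ hc.le
    nlinarith [sq_nonneg (m - δ)]

/-- If `∫|u|² > 0`, the lower bound with `δ` equal to half of it keeps `N^{1/3} W_N` away from zero,
against decay faster than `N^{-1/3}`. -/
theorem ae_eq_zero_of_polyDecay (hT : MeasurePreserving T μ μ) {k : ℕ} {α : ℝ} (hα : 1 / 3 < α)
    {u : X → ℂ} (hu : Measurable u) (hu1 : ∀ x, ‖u x‖ ≤ 1)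
    (hdec : PolyDecay α fun N => wwAvg μ T N (k + 1) u) : u =ᵐ[μ] 0 := by
  obtain ⟨C, hC, hdec⟩ := hdec
  obtain ⟨h0, -⟩ := integral_sq_norm_mem μ hu hu1
  have hi : Integrable (fun x => ‖u x‖ ^ 2) μ :=
    integrable_of_norm_le (C := 1) (hu.norm.pow_const 2).aestronglyMeasurable fun x => by
      rw [Real.norm_of_nonneg (by positivity)]
      exact pow_le_one₀ (norm_nonneg _) (hu1 _)
  rcases h0.eq_or_lt with h | hpos
  · have := (integral_eq_zero_iff_of_nonneg (fun x => by positivity) hi).1 h.symm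
    filter_upwards [this] with x hx
    simpa using hx
  · exfalso
    obtain ⟨c, hc, N₀, hN₀⟩ := exists_wwAvg_lower_bound hT k _ (half_pos hpos)
    have hlim : Filter.Tendsto (fun N : ℕ => C * (N : ℝ) ^ (-(α - 1 / 3))) Filter.atTop
        (nhds (C * 0)) :=
      ((tendsto_rpow_neg_atTop (by linarith)).comp tendsto_natCast_atTop_atTop).const_mul C
    rw [mul_zero] at hlim
    have hev := hlim.eventually_lt_const (u := c * ((∫ x, ‖u x‖ ^ 2 ∂μ) / 2)) (by positivity)
    obtain ⟨N, hN, hNN₀, hN1⟩ :=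
      (hev.and ((Filter.eventually_ge_atTop N₀).and (Filter.eventually_ge_atTop 1))).exists
    have hN' : (0 : ℝ) < N := by exact_mod_cast hN1
    have h1 := hN₀ N hNN₀ u hu hu1
    have h2 : (N : ℝ) ^ (1 / 3 : ℝ) * wwAvg μ T N (k + 1) u ≤ C * (N : ℝ) ^ (-(α - 1 / 3)) := by
      calc _ ≤ (N : ℝ) ^ (1 / 3 : ℝ) * (C * (N : ℝ) ^ (-α)) := by
            gcongr
            exact hdec N hN1
        _ = _ := by
            rw [mul_left_comm, ← Real.rpow_add hN']
            congr 2
            ring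
    have h3 : c * (∫ x, ‖u x‖ ^ 2 ∂μ - (∫ x, ‖u x‖ ^ 2 ∂μ) / 2) =
        c * ((∫ x, ‖u x‖ ^ 2 ∂μ) / 2) := by ring
    rw [h3] at h1
    linarith

end System

/-! ### Stability of power type and the main theorem -/

theorem wwAvg_zero {X : Type*} [MeasurableSpace X] (μ : Measure X) (T : X → X) (N k : ℕ) :
    wwAvg μ T N (k + 1) 0 = 0 := by
  have := wwAvg_const_mul μ T N k 0 0
  rw [norm_zero, Real.zero_rpow (by positivity), zero_mul] at this
  simp only [zero_mul] at this
  exact this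

theorem PolyDecay.of_const_mul {α c : ℝ} (hc : 0 < c) {r : ℕ → ℝ}
    (h : PolyDecay α fun N => c * r N) : PolyDecay α r := by
  obtain ⟨C, hC, h⟩ := h
  refine ⟨c⁻¹ * C, by positivity, fun N hN => ?_⟩
  rw [mul_assoc, ← div_eq_inv_mul, le_div_iff₀' hc]
  exact h N hN

theorem isWWFunction_tensorFun {X Y : Type*} [MeasurableSpace X] [MeasurableSpace Y]
    {μ : Measure X} [IsProbabilityMeasure μ] {T : X → X} (hT : MeasurePreserving T μ μ)
    {ν : Measure Y} [IsProbabilityMeasure ν] {S : Y → Y} (hS : MeasurePreserving S ν ν)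
    {k : ℕ} (hk : 1 ≤ k) {α : ℝ} {f : X → ℂ} (hf : IsWWFunction μ T (k + 1) α f) {g : Y → ℂ}
    (hg : MemLp g ∞ ν) :
    IsWWFunction (μ.prod ν) (Prod.map T S) k (α / 8) (tensorFun f g) := by
  obtain ⟨k, rfl⟩ := Nat.exists_eq_add_of_le' hk
  obtain ⟨hfL, hdec⟩ := hf
  obtain ⟨A, u, hA, hum, hu1, hfu⟩ := exists_normalization hfL
  obtain ⟨B, v, hB, hvm, hv1, hgv⟩ := exists_normalization hg
  have hfg := tensorFun_ae_eq hfu hgv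
  have hscale : tensorFun (fun x => (A : ℂ) * u x) (fun y => (B : ℂ) * v y) =
      fun p => ((A : ℂ) * B) * tensorFun u v p := by
    funext p
    simp only [tensorFun]
    ring
  rw [hscale] at hfg
  have hu : PolyDecay α fun N => wwAvg μ T N (k + 1 + 1) u := by
    simp_rw [wwAvg_congr_ae hT _ _ hfu, wwAvg_const_mul] at hdec
    exact hdec.of_const_mul (Real.rpow_pos_of_pos (by simpa using hA.ne') _)
  refine ⟨?_, ?_⟩
  · refine MemLp.ae_eq hfg.symm (memLp_top_of_bound (C := ‖(A : ℂ) * B‖)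
      ((measurable_tensorFun hum hvm).const_mul _).aestronglyMeasurable (ae_of_all _ fun p => ?_))
    rw [norm_mul]
    exact mul_le_of_le_one_right (norm_nonneg _) (norm_tensorFun_le_one hu1 hv1 p)
  simp_rw [wwAvg_congr_ae (hT.prod hS) _ _ hfg, wwAvg_const_mul]
  set K := ‖(A : ℂ) * B‖ ^ (2 / 3 * 2 ^ k : ℝ) with hK
  have hK0 : 0 ≤ K := Real.rpow_nonneg (norm_nonneg _) _
  -- The error `N^{-1/6}` is absorbed by `N^{-α/8}` whenever `α ≤ 4/3`; splitting already at `1/3`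
  -- works because above it `u` vanishes almost everywhere.
  rcases le_or_gt α (1 / 3) with hα | hα
  · obtain ⟨C, hC, hu⟩ := hu
    -- Only `0 ≤ K` is recorded; the added 1 makes the constant positive.
    refine ⟨K * (16 * (1 + C ^ (1 / 8 : ℝ))) + 1, by positivity, fun N hN => ?_⟩
    have hN' : (1 : ℝ) ≤ N := by exact_mod_cast hN
    have hN0 : (0 : ℝ) ≤ N := by linarith
    have h1 : wwAvg μ T N (k + 1 + 1) u ^ (1 / 8 : ℝ) ≤
        C ^ (1 / 8 : ℝ) * (N : ℝ) ^ (-(α / 8)) := by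
      calc _ ≤ (C * (N : ℝ) ^ (-α)) ^ (1 / 8 : ℝ) :=
            Real.rpow_le_rpow (wwAvg_nonneg _ _ _ _ _) (hu N hN) (by norm_num)
        _ = _ := by
            rw [Real.mul_rpow hC.le (by positivity), ← Real.rpow_mul hN0]
            congr 2
            ring
    have h2 : 1 / (N : ℝ) ^ (1 / 6 : ℝ) ≤ (N : ℝ) ^ (-(α / 8)) := by
      rw [one_div, ← Real.rpow_neg hN0]
      exact Real.rpow_le_rpow_of_exponent_le hN' (by linarith)
    have hNpos : 0 ≤ (N : ℝ) ^ (-(α / 8)) := by positivity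
    calc _ ≤ K * (16 * (1 / (N : ℝ) ^ (1 / 6 : ℝ) +
          wwAvg μ T N (k + 1 + 1) u ^ (1 / 8 : ℝ))) := by
          refine mul_le_mul_of_nonneg_left ?_ hK0
          exact wwAvg_tensorFun_le hT.measurable hS hN k hum hvm hu1 hv1
      _ ≤ K * (16 * ((N : ℝ) ^ (-(α / 8)) + C ^ (1 / 8 : ℝ) * (N : ℝ) ^ (-(α / 8)))) := by
          gcongr
      _ ≤ _ := by nlinarith
  · have h0 : tensorFun u v =ᵐ[μ.prod ν] 0 := by
      refine (tensorFun_ae_eq (ae_eq_zero_of_polyDecay hT hα hum hu1 hu)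
        (Filter.EventuallyEq.refl _ v)).trans (Filter.EventuallyEq.of_eq ?_)
      funext p
      simp [tensorFun]
    refine ⟨1, one_pos, fun N _ => ?_⟩
    simp only [wwAvg_congr_ae (hT.prod hS) _ _ h0, wwAvg_zero, mul_zero]
    positivity
theorem corollaryC :
    -- the product bound, with an absolute constant
    (∃ C : ℝ, 0 < C ∧
      ∀ (k : ℕ), 1 ≤ k →
      ∀ (X : Type*) [MeasurableSpace X] (μ : Measure X) [IsProbabilityMeasure μ] (T : X → X)
        (Y : Type*) [MeasurableSpace Y] (ν : Measure Y) [IsProbabilityMeasure ν] (S : Y → Y),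
      MeasurePreserving T μ μ → MeasurePreserving S ν ν →
      ∀ (f : X → ℂ) (g : Y → ℂ), MemLp f ∞ μ → MemLp g ∞ ν →
      (∀ᵐ x ∂μ, ‖f x‖ ≤ 1) → (∀ᵐ y ∂ν, ‖g y‖ ≤ 1) →
      ∀ N : ℕ, 1 ≤ N →
        wwAvg (μ.prod ν) (Prod.map T S) N k (tensorFun f g) ≤
          C * (1 / (N : ℝ) ^ (1 / 6 : ℝ) +
            (min (wwAvg μ T N (k + 1) f) (wwAvg ν S N (k + 1) g)) ^ (1 / 8 : ℝ))) ∧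
    -- its asymptotic form, with absolute constants
    (∃ (a b c C : ℝ) (N₀ : ℕ) (φ : ℕ → ℕ),
      ∀ (k : ℕ), 1 ≤ k →
      ∀ (X : Type*) [MeasurableSpace X] (μ : Measure X) [IsProbabilityMeasure μ] (T : X → X)
        (Y : Type*) [MeasurableSpace Y] (ν : Measure Y) [IsProbabilityMeasure ν] (S : Y → Y),
      MeasurePreserving T μ μ → MeasurePreserving S ν ν →
      ∀ (f : X → ℂ) (g : Y → ℂ), MemLp f ∞ μ → MemLp g ∞ ν →
      (∀ᵐ x ∂μ, ‖f x‖ ≤ 1) → (∀ᵐ y ∂ν, ‖g y‖ ≤ 1) →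
        PrecsimWith a b c C N₀ φ
          (fun N => wwAvg (μ.prod ν) (Prod.map T S) N k (tensorFun f g))
          (fun N => min (wwAvg μ T N (k + 1) f) (wwAvg ν S N (k + 1) g))) ∧
    -- stability of Wiener-Wintner functions of power type under products
    (∀ (k : ℕ), 1 ≤ k → ∀ (α : ℝ), 0 < α →
      ∀ (X : Type*) [MeasurableSpace X] (μ : Measure X) [IsProbabilityMeasure μ] (T : X → X),
      MeasurePreserving T μ μ →
      ∀ (f : X → ℂ), IsWWFunction μ T (k + 1) α f →
      ∀ (Y : Type*) [MeasurableSpace Y] (ν : Measure Y) [IsProbabilityMeasure ν] (S : Y → Y),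
      MeasurePreserving S ν ν →
      ∀ (g : Y → ℂ), MemLp g ∞ ν →
        IsWWFunction (μ.prod ν) (Prod.map T S) k (α / 8) (tensorFun f g)) := by
  -- The comparison holds at the same `N`, so `φ` is the identity with `b = 1`, and no initial
  -- segment is excluded.
  refine ⟨⟨16, by norm_num, ?_⟩, ⟨1 / 6, 1, 1 / 8, 16, 0, id, ?_⟩, ?_⟩
  · intro k hk X _ μ _ T Y _ ν _ S hT hS f g hf hg hf1 hg1 N hN
    exact wwAvg_tensorFun_le_min hT hS hf.1 hg.1 hf1 hg1 hk hN
  · intro k hk X _ μ _ T Y _ ν _ S hT hS f g hf hg hf1 hg1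
    refine ⟨by norm_num, by norm_num, by norm_num, by norm_num, monotone_id, fun N => ?_,
      fun N hN => ?_⟩
    · rw [Real.rpow_one, id]
    · exact wwAvg_tensorFun_le_min hT hS hf.1 hg.1 hf1 hg1 hk hN
  · intro k hk α _ X _ μ _ T hT f hf Y _ ν _ S hS g hg
    exact isWWFunction_tensorFun hT hS hk hf hg
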